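/- A ballean is a set $X$ with a family $\mathcal E_X$ of reflexive symmetric relations (radii) on $X$ such that $\bigcup\mathcal E_X=X\times X$ and for all $\varepsilon,\delta\in\mathcal E_X$ the composition $\varepsilon\circ\delta$ is contained in some $\eta\in\mathcal E_X$. Put $B(x,\varepsilon)=\{y:(x,y)\in\varepsilon\}$ and $B(A,\varepsilon)=\bigcup_{a\in A}B(a,\varepsilon)$. The coarse structure ${\downarrow}\mathcal E_X$ consists of all reflexive symmetric relations contained in some $\varepsilon\in\mathcal E_X$; a base of it is a family $\mathcal B\subseteq{\downarrow}\mathcal E_X$ such that every element of ${\downarrow}\mathcal E_X$ is contained in an element of $\mathcal B$, and $\mathrm{cof}(X)$ is the smallest cardinality of a base. The ballean is ordinal if ${\downarrow}\mathcal E_X$ has a base $\{B_\alpha\}_{\alpha<\kappa}\subseteq\mathcal E_X$, indexed by an ordinal $\kappa$, with $B_\alpha\subseteq B_\beta$ for $\alpha<\beta<\kappa$; it is cellular if ${\downarrow}\mathcal E_X$ has a base consisting of equivalence relations. A subset $A\subseteq X$ carries the ballean structure $\{\varepsilon\cap A^2:\varepsilon\in\mathcal E_X\}$, and is then called a subspace;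 $L\subseteq X$ is large if $X=B(L,\varepsilon)$ for some $\varepsilon\in\mathcal E_X$. A map $f:X\to Y$ of balleans is coarse if for each $\varepsilon\in\mathcal E_X$ there is $\delta\in\mathcal E_Y$ with $(f(x),f(y))\in\delta$ for all $(x,y)\in\varepsilon$. Two balleans are coarsely equivalent if they contain large subspaces $L_X$, $L_Y$ admitting a bijection $L_X\to L_Y$ that is coarse together with its inverse. For $A\subseteq X$ let $\mathrm{cov}_\varepsilon(A)=\min\{|C|:C\subseteq X,\ A\subseteq B(C,\varepsilon)\}$. Let $\mathrm{cov}^\sharp(X)$ be the smallest cardinal $\kappa$ for which there is $\varepsilon\in\mathcal E_X$ such that $\sup_{x\in X}\mathrm{cov}_\varepsilon(B(x,\delta))<\kappa$ for every $\delta\in\mathcal E_X$, and let $\mathrm{cov}^\flat(X)$ be the largest cardinal $\kappa$ such that for every cardinal $\lambda<\kappa$ and every $\varepsilon\in\mathcal E_X$ there is $\delta\in\mathcal E_X$ with $\min_{x\in X}\mathrm{cov}_\varepsilon(B(x,\delta))\ge\lambda$. For an ordinal $\gamma\neq 0$ let $\mathrm{cf}(\gamma)$ be its cofinality, let $\lceil\gamma\rceil=\min\{\alpha:\gamma\le\beta+|\alpha|\text{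 for some }\beta<\gamma\}$ (a cardinal), and let $2^{<\gamma}$ be the ballean of all finitely supported functions $x:\gamma\to\{0,1\}$ with the radii $\varepsilon_\beta=\{(x,y):x_\alpha=y_\alpha\text{ for all }\alpha>\beta\}$, $\beta<\gamma$. Theorem. Let $\gamma$ be a nonzero ordinal and let $X$ be a nonempty cellular ordinal ballean with $\mathrm{cof}(X)=\mathrm{cf}(\gamma)$. (1) If $\lceil\gamma\rceil\le\mathrm{cov}^\flat(X)$, then $2^{<\gamma}$ is coarsely equivalent to a subspace of $X$. (2) If $\mathrm{cov}^\sharp(X)\le\lceil\gamma\rceil$, then $X$ is coarsely equivalent to a subspace of $2^{<\gamma}$. (3) If $\mathrm{cov}^\flat(X)=\mathrm{cov}^\sharp(X)=\lceil\gamma\rceil$, then $X$ is coarsely equivalent to $2^{<\gamma}$. -/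

import Mathlib

open Cardinal

universe u v

/-- An entourage on `X`: a reflexive and symmetric relation. -/
def IsEntourage {X : Type u} (ε : SetRel X X) : Prop := ε.IsRefl ∧ ε.IsSymm

/-- A ballean structure on `X`: a family of entourages (the set of radii) whose union is `X × X`,
such that the composition of two radii is contained in a radius. -/
structure Ballean (X : Type u) where
  /-- The set of radii. -/
  radii : Set (SetRel X X)
  isEntourage : ∀ ε ∈ radii, IsEntourage ε
  sUnion_radii : ⋃₀ radii = Set.univ
  comp_subset : ∀ ε ∈ radii, ∀ δ ∈ radii, ∃ η ∈ radii, ε.comp δ ⊆ η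

namespace Ballean

/-- The ball `B(x, ε)`. -/
def ball {X : Type u} (x : X) (ε : SetRel X X) : Set X := {y | (x, y) ∈ ε}

/-- The neighbourhood `B(A, ε)`, the union of the balls `B(a, ε)`, `a ∈ A`. -/
def nhd {X : Type u} (A : Set X) (ε : SetRel X X) : Set X := ⋃ a ∈ A, ball a ε

/-- The coarse structure `↓E` generated by the radii: all entourages contained in a radius. -/
def coarseStructure {X : Type u} (E : Ballean X) : Set (SetRel X X) :=
  {δ | IsEntourage δ ∧ ∃ ε ∈ E.radii, δ ⊆ ε}

/-- `B` is a base of the coarse structure `↓E`. -/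
def IsBase {X : Type u} (E : Ballean X) (B : Set (SetRel X X)) : Prop :=
  B ⊆ E.coarseStructure ∧ ∀ δ ∈ E.coarseStructure, ∃ ε ∈ B, δ ⊆ ε

/-- The smallest cardinality of a base of the coarse structure. -/
noncomputable def cof {X : Type u} (E : Ballean X) : Cardinal.{u} :=
  sInf {c | ∃ B : Set (SetRel X X), E.IsBase B ∧ #B = c}

/-- The coarse structure has a base `(B_α)_{α < κ}` consisting of radii, indexed by an ordinal `κ`,
with `B_α ⊆ B_β` whenever `α ≤ β`. -/
def IsOrdinal {X : Type u} (E : Ballean X) : Prop :=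
  ∃ (κ : Ordinal.{u}) (B : κ.ToType → SetRel X X),
    Monotone B ∧ Set.range B ⊆ E.radii ∧ E.IsBase (Set.range B)

/-- The coarse structure has a base consisting of equivalence relations (entourages are reflexive
and symmetric already). -/
def IsCellular {X : Type u} (E : Ballean X) : Prop :=
  ∃ B : Set (SetRel X X), E.IsBase B ∧ ∀ ε ∈ B, ε.IsTrans

/-- The smallest number of `ε`-balls covering `A`. -/
noncomputable def cov {X : Type u} (ε : SetRel X X) (A : Set X) : Cardinal.{u} :=
  sInf {c | ∃ C : Set X, A ⊆ nhd C ε ∧ #C = c}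

/-- The covering number `cov^♯`. -/
noncomputable def covSharp {X : Type u} (E : Ballean X) : Cardinal.{u} :=
  sInf {κ | ∃ ε ∈ E.radii, ∀ δ ∈ E.radii, ⨆ x : X, cov ε (ball x δ) < κ}

/-- The covering number `cov^♭`; see `covFlat_isGreatest`. -/
noncomputable def covFlat {X : Type u} (E : Ballean X) : Cardinal.{u} :=
  sSup {κ | ∀ μ < κ, ∀ ε ∈ E.radii, ∃ δ ∈ E.radii, μ ≤ ⨅ x : X, cov ε (ball x δ)}

/-- On a nonempty ballean the supremum in the definition of `covFlat` is a maximum. -/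
theorem covFlat_isGreatest {X : Type u} [Nonempty X] (E : Ballean X) :
    IsGreatest {κ : Cardinal.{u} | ∀ μ < κ, ∀ ε ∈ E.radii, ∃ δ ∈ E.radii,
      μ ≤ ⨅ x : X, cov ε (ball x δ)} E.covFlat := by
  obtain ⟨x₀⟩ := ‹Nonempty X›
  obtain ⟨ε, hε, -⟩ : ((x₀, x₀) : X × X) ∈ ⋃₀ E.radii := by
    rw [E.sUnion_radii]; trivial
  have hb : BddAbove {κ : Cardinal.{u} | ∀ μ < κ, ∀ ε ∈ E.radii, ∃ δ ∈ E.radii,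
      μ ≤ ⨅ x : X, cov ε (ball x δ)} := by
    refine ⟨Order.succ #X, fun κ hκ => ?_⟩
    by_contra! h
    obtain ⟨δ, -, h2⟩ := hκ _ h ε hε
    have h3 : Order.succ #X ≤ cov ε (ball x₀ δ) := h2.trans (ciInf_le' _ x₀)
    have h4 : cov ε (ball x₀ δ) ≤ #X := by
      refine csInf_le' ⟨Set.univ, fun y _ => ?_, Cardinal.mk_univ⟩
      exact Set.mem_biUnion (Set.mem_univ y) ((E.isEntourage ε hε).1.refl y)
    exact absurd (h3.trans h4) (not_le.2 (Order.lt_succ _))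
  refine ⟨fun μ hμ ε hε => ?_, fun κ hκ => le_csSup hb hκ⟩
  obtain ⟨κ, hκ, h⟩ := exists_lt_of_lt_csSup' hμ
  exact hκ μ h ε hε

/-- The subballean on `A ⊆ X`, with radii `ε ∩ A²`. -/
def sub {X : Type u} (E : Ballean X) (A : Set X) : Ballean A where
  radii := (fun ε : SetRel X X => {p : A × A | ((p.1 : X), (p.2 : X)) ∈ ε}) '' E.radii
  isEntourage := by
    rintro _ ⟨ε, hε, rfl⟩
    obtain ⟨h1, h2⟩ := E.isEntourage ε hε
    exact ⟨⟨fun a => h1.refl (a : X)⟩, ⟨fun a b h => h2.symm (a : X) (b : X) h⟩⟩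
  sUnion_radii := by
    refine Set.eq_univ_of_forall fun p => ?_
    obtain ⟨ε, hε, h⟩ : ((p.1 : X), (p.2 : X)) ∈ ⋃₀ E.radii := by
      rw [E.sUnion_radii]; trivial
    exact ⟨_, ⟨ε, hε, rfl⟩, h⟩
  comp_subset := by
    rintro _ ⟨ε, hε, rfl⟩ _ ⟨δ, hδ, rfl⟩
    obtain ⟨η, hη, h⟩ := E.comp_subset ε hε δ hδ
    refine ⟨_, ⟨η, hη, rfl⟩, ?_⟩
    rintro ⟨a, c⟩ ⟨b, hab, hbc⟩
    exact h ⟨(b : X), hab, hbc⟩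

/-- A coarse map between balleans. -/
def IsCoarseMap {X : Type u} {Y : Type v} (E : Ballean X) (F : Ballean Y) (f : X → Y) : Prop :=
  ∀ ε ∈ E.radii, ∃ δ ∈ F.radii, ∀ x y, (x, y) ∈ ε → (f x, f y) ∈ δ

/-- There is a bijection which is coarse in both directions. -/
def CoarselyIsomorphic {X : Type u} {Y : Type v} (E : Ballean X) (F : Ballean Y) : Prop :=
  ∃ f : X ≃ Y, IsCoarseMap E F f ∧ IsCoarseMap F E f.symm

/-- `L` is large if `X = B(L, ε)` for some radius `ε`. -/
def IsLarge {X : Type u} (E : Ballean X) (L : Set X) : Prop :=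
  ∃ ε ∈ E.radii, nhd L ε = Set.univ

/-- Two balleans are coarsely equivalent if they contain coarsely isomorphic large subspaces. -/
def CoarselyEquivalent {X : Type u} {Y : Type v} (E : Ballean X) (F : Ballean Y) : Prop :=
  ∃ (L : Set X) (M : Set Y), E.IsLarge L ∧ F.IsLarge M ∧ CoarselyIsomorphic (E.sub L) (F.sub M)

/-- The entourage on finitely supported `0`-`1` sequences indexed by the ordinals `α < γ` which
relates sequences that agree at all indices `α > β`. -/
def cubeEntourage {γ : Ordinal.{u}} (β : γ.ToType) :
    SetRel (γ.ToType →₀ Fin 2) (γ.ToType →₀ Fin 2) :=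
  {p | ∀ α, β < α → p.1 α = p.2 α}

/-- The Cantor macro-cube `2^{<γ}`: all finitely supported functions from `γ` to `{0, 1}`, with the
radii `cubeEntourage β`, `β < γ`. (For `γ = 0` there are no radii and this is not a ballean.) -/
def cantorMacroCube (γ : Ordinal.{u}) (hγ : γ ≠ 0) : Ballean (γ.ToType →₀ Fin 2) where
  radii := Set.range cubeEntourage
  isEntourage := by
    rintro _ ⟨β, rfl⟩
    exact ⟨⟨fun x α _ => rfl⟩, ⟨fun x y h α hα => (h α hα).symm⟩⟩
  sUnion_radii := by
    refine Set.eq_univ_of_forall fun p => ?_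
    have : Nonempty γ.ToType := Ordinal.nonempty_toType_iff.2 hγ
    obtain ⟨β, hβ⟩ := (p.1.support ∪ p.2.support).exists_le
    refine ⟨_, ⟨β, rfl⟩, fun α hα => ?_⟩
    have h : α ∉ p.1.support ∪ p.2.support := fun h => absurd (hβ α h) (not_le.2 hα)
    rw [Finset.mem_union, not_or, Finsupp.notMem_support_iff, Finsupp.notMem_support_iff] at h
    rw [h.1, h.2]
  comp_subset := by
    rintro _ ⟨β, rfl⟩ _ ⟨β', rfl⟩
    refine ⟨_, ⟨max β β', rfl⟩, ?_⟩
    rintro ⟨x, z⟩ ⟨y, hxy, hyz⟩ α hα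
    exact (hxy α ((le_max_left _ _).trans_lt hα)).trans (hyz α ((le_max_right _ _).trans_lt hα))

end Ballean

/-- The cardinal tail `⌈γ⌉` of a nonzero ordinal `γ`: the smallest ordinal `α` such that
`γ ≤ β + |α|` for some `β < γ`. As `|α| ≤ α` has the same property, this smallest ordinal is a
cardinal, and it is recorded as such. -/
noncomputable def cardinalTail (γ : Ordinal.{u}) : Cardinal.{u} :=
  (sInf {α : Ordinal.{u} | ∃ β < γ, γ ≤ β + α.card.ord}).card

/-! If γ is a successor, both balleans are bounded and a constant map suffices. Let γ be a limit and
κ = ⌈γ⌉. The macro-cube satisfies `covSharp` ≤ κ ≤ `covFlat` (`covSharp_cantorMacroCube_le`,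
`le_covFlat_cantorMacroCube`), so (1) and (2) follow from `exists_isCoarseEmbedding`: `covSharp` of
the source at most `covFlat` of the target gives a coarse embedding.

Equal cofinality allows a simultaneous transfinite construction of cofinal towers of bounded
equivalence relations in both balleans, over one well-order. At each level the source has at most as
many old classes in a new class as the target. Local injections of old classes, chosen for all pairs
of base points, are composed along a descent: a point x at distance m from p is approached through a
representative of its class below level m. Distances decrease in a well-order, so this stops, and
the resulting map preserves and reflects every level (`TowerMatching.map_rel_map_iff`).

For (3) with κ uncountable, classes can be regrouped so that every new class contains exactly n old
ones, for one infinite n < κ and in both towers (`exists_grouping`). The local injections become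
bijections and the map has large image.

For κ = ℵ₀ the counts are finite and cannot be equalized in general (powers of 2 against powers of
3). Here the cofinality is ω, and a ballean becomes a line: points sit on ℕ and the classes of level
i are the blocks between the cutting points of level i (`exists_isLine`). Thinning the cutting
points of two lines alternately and fast, one finds an increasing map that interleaves them at all
levels (`IsSparseSequence.exists_transfer`). It is a limit of finite back-and-forth constructions,
kept under control by bi-Lipschitz constants tending to 1. -/

/-- `φ` maps the `D`-class of `p` into the `D'`-class of `q`, the class of `p` to the class of `q`,
and it induces an injection of the `L`-classes into the `L'`-classes. -/
structure IsMatching {X : Type u} {Y : Type v} (L D : Setoid X) (L' D' : Setoid Y) (p : X) (q : Y)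
    (φ : X → Y) : Prop where
  maps : ∀ x, D x p → D' (φ x) q
  rel_iff : ∀ x x', D x p → D x' p → (L x x' ↔ L' (φ x) (φ x'))
  center : L' (φ p) q

/-- A matching hits every `L'`-class in the `D'`-class of `q`. -/
def IsOntoMatching {X : Type u} {Y : Type v} (D : Setoid X) (L' D' : Setoid Y) (p : X) (q : Y)
    (φ : X → Y) : Prop := ∀ y, D' y q → ∃ x, D x p ∧ L' (φ x) y

/-! ### Maps between towers of equivalence relations -/

section Tower

variable {I : Type*} [LinearOrder I] [WellFoundedLT I] [OrderBot I] {X : Type u} {Y : Type v}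

/-- The smallest level at which two points are identified. -/
noncomputable def towerDist (E : I → Setoid X) (x y : X) : I :=
  open Classical in if h : ∃ i, E i x y then wellFounded_lt.min {i | E i x y} h else ⊥

theorem towerDist_spec {E : I → Setoid X} (ex : ∀ x y, ∃ i, E i x y) (x y : X) :
    E (towerDist E x y) x y := by
  rw [towerDist, dif_pos (ex x y)]
  exact wellFounded_lt.min_mem {i | E i x y} _

theorem towerDist_le {E : I → Setoid X} {x y : X} {i : I} (h : E i x y) :
    towerDist E x y ≤ i := by
  rw [towerDist, dif_pos ⟨i, h⟩]
  exact not_lt.1 (wellFounded_lt.not_lt_min {i | E i x y} h)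

/-- A representative of the class of a point. -/
noncomputable def Setoid.rep (L : Setoid X) (x : X) : X := Quotient.out (Quotient.mk L x)

theorem Setoid.rel_rep (L : Setoid X) (x : X) : L x (L.rep x) :=
  L.symm (Quotient.exact (Quotient.out_eq (Quotient.mk L x)))

theorem Setoid.rep_eq {L : Setoid X} {x y : X} (h : L x y) : L.rep x = L.rep y := by
  unfold Setoid.rep
  rw [show Quotient.mk L x = Quotient.mk L y from Quotient.sound h]

/-- The data which determine a map between two towers of equivalence relations: `E`, `F` are the
towers, `L i`, `M i` the unions of the relations below `i`. -/
structure TowerMatching (E L : I → Setoid X) (F M : I → Setoid Y) (φ : I → X → Y → X → Y) :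
    Prop where
  monoE : Monotone E
  monoF : Monotone F
  exE : ∀ x y, ∃ i, E i x y
  exF : ∀ x y, ∃ i, F i x y
  lowE : ∀ i ≠ ⊥, ∀ x y, L i x y ↔ ∃ j < i, E j x y
  lowF : ∀ i ≠ ⊥, ∀ x y, M i x y ↔ ∃ j < i, F j x y
  matching : ∀ i ≠ ⊥, ∀ p q, IsMatching (L i) (E i) (M i) (F i) p q (φ i p q)

variable {E L : I → Setoid X} {F M : I → Setoid Y} {φ : I → X → Y → X → Y}

theorem TowerMatching.dist_rep_lt (T : TowerMatching E L F M φ) {x p : X}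
    (h : towerDist E x p ≠ ⊥) :
    towerDist E x ((L (towerDist E x p)).rep x) < towerDist E x p := by
  obtain ⟨j, hj, h'⟩ := (T.lowE _ h _ _).1 ((L (towerDist E x p)).rel_rep x)
  exact (towerDist_le h').trans_lt hj

open Classical in
/-- The map between two towers obtained by descending along the levels. -/
noncomputable def TowerMatching.map (T : TowerMatching E L F M φ) (x p : X) (q : Y) : Y :=
  if h : towerDist E x p = ⊥ then q
  else T.map x ((L (towerDist E x p)).rep x)
    (φ (towerDist E x p) p q ((L (towerDist E x p)).rep x))
termination_by (wellFounded_lt (α := I)).wrap (towerDist E x p)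
decreasing_by exact T.dist_rep_lt h

theorem TowerMatching.map_bot (T : TowerMatching E L F M φ) {x p : X} (q : Y)
    (h : towerDist E x p = ⊥) : T.map x p q = q := by
  rw [TowerMatching.map, dif_pos h]

theorem TowerMatching.map_step (T : TowerMatching E L F M φ) {x p : X} (q : Y) {m : I}
    (hm : towerDist E x p = m) (h : m ≠ ⊥) :
    T.map x p q = T.map x ((L m).rep x) (φ m p q ((L m).rep x)) := by
  subst hm
  rw [TowerMatching.map, dif_neg h]

theorem TowerMatching.le_low (T : TowerMatching E L F M φ) {j i : I} (h : j < i) : F j ≤ M i := by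
  intro x y hxy
  exact (T.lowF i h.ne_bot x y).2 ⟨j, h, hxy⟩

theorem TowerMatching.low_le (T : TowerMatching E L F M φ) {i : I} (h : i ≠ ⊥) : L i ≤ E i := by
  intro x y hxy
  obtain ⟨j, hj, h'⟩ := (T.lowE i h x y).1 hxy
  exact T.monoE hj.le h'

theorem TowerMatching.rel_of_dist (T : TowerMatching E L F M φ) {x p : X} {i : I}
    (h : towerDist E x p ≤ i) : E i x p := T.monoE h (towerDist_spec T.exE x p)

theorem TowerMatching.map_rel (T : TowerMatching E L F M φ) (x p : X) (q : Y) (i : I)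
    (h : E i x p) : F i (T.map x p q) q := by
  induction hm : towerDist E x p using WellFoundedLT.induction generalizing p q i with
  | ind m ih =>
  by_cases hb : m = ⊥
  · rw [T.map_bot q (hm.trans hb)]
  · have hmi : m ≤ i := hm ▸ towerDist_le h
    have hr := (L m).rel_rep x
    have hlt : towerDist E x ((L m).rep x) < m := by
      subst hm; exact T.dist_rep_lt hb
    rw [T.map_step q hm hb]
    refine T.monoF hmi ?_
    refine (F m).trans (T.monoF hlt.le (ih _ hlt _ _ _ (towerDist_spec T.exE _ _) rfl)) ?_
    refine (T.matching m hb p q).maps _ ?_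
    exact (E m).trans ((E m).symm (T.low_le hb hr)) (T.rel_of_dist hm.le)

/-- This is the isosceles property of the ultrametric `towerDist`. -/
theorem TowerMatching.dist_eq (T : TowerMatching E L F M φ) {x x' p : X} {i : I} (h : E i x x')
    (hi : i < towerDist E x p) : towerDist E x' p = towerDist E x p := by
  apply le_antisymm
  · exact towerDist_le ((E _).trans ((E _).symm (T.monoE hi.le h)) (towerDist_spec T.exE x p))
  · by_contra! hlt
    have : E (max i (towerDist E x' p)) x p :=
      (E _).trans (T.monoE (le_max_left _ _) h)
        (T.monoE (le_max_right _ _) (towerDist_spec T.exE x' p))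
    exact absurd (towerDist_le this) (not_le.2 (max_lt hi hlt))

/-- Two points related at level i have the same descent as long as the level exceeds i. Once it is
at most i, both images lie in the `F i`-class of the current target base point. -/
theorem TowerMatching.map_rel_map (T : TowerMatching E L F M φ) (x x' p : X) (q : Y) (i : I)
    (h : E i x x') : F i (T.map x p q) (T.map x' p q) := by
  induction hm : towerDist E x p using WellFoundedLT.induction generalizing p q with
  | ind m ih =>
  rcases le_or_gt m i with hmi | hmi
  · have hx : E i x p := T.rel_of_dist (hm.le.trans hmi)
    exact (F i).trans (T.map_rel x p q i hx)
      ((F i).symm (T.map_rel x' p q i ((E i).trans ((E i).symm h) hx)))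
  · have hm' : towerDist E x' p = m := (T.dist_eq h (hm ▸ hmi)).trans hm
    have hb : m ≠ ⊥ := hmi.ne_bot
    have hL : L m x x' := (T.lowE m hb _ _).2 ⟨i, hmi, h⟩
    rw [T.map_step q hm hb, T.map_step q hm' hb, ← Setoid.rep_eq hL]
    refine ih _ ?_ _ _ rfl
    subst hm; exact T.dist_rep_lt hb

/-- After the step at level k the descent moves the image only inside its `M k`-class. If x is
closer to p than k, that step is skipped, and `center` shows that it would have changed nothing
modulo `M k`. -/
theorem TowerMatching.map_low (T : TowerMatching E L F M φ) (x p : X) (q : Y) {k : I}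
    (hk : k ≠ ⊥) (h : towerDist E x p ≤ k) : M k (T.map x p q) (φ k p q x) := by
  have hmat := T.matching k hk p q
  rcases h.lt_or_eq with h | h
  · have hx : L k x p := (T.lowE k hk x p).2 ⟨_, h, towerDist_spec T.exE x p⟩
    have h1 : M k (φ k p q x) (φ k p q p) :=
      (hmat.rel_iff x p (T.rel_of_dist h.le) ((E k).refl p)).1 hx
    have h2 : M k (T.map x p q) q := T.le_low h (T.map_rel x p q _ (towerDist_spec T.exE x p))
    exact (M k).trans h2 ((M k).symm ((M k).trans h1 hmat.center))
  · rw [T.map_step q h hk]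
    have hr := (L k).rel_rep x
    have hlt : towerDist E x ((L k).rep x) < k := by
      subst h; exact T.dist_rep_lt hk
    have hx : E k x p := T.rel_of_dist h.le
    refine (M k).trans (T.le_low hlt (T.map_rel _ _ _ _ (towerDist_spec T.exE _ _))) ?_
    refine (hmat.rel_iff _ _ ?_ hx).1 ((L k).symm hr)
    exact (E k).trans ((E k).symm (T.low_le hk hr)) hx

/-- Above level k the two descents coincide; at level k they meet distinct `L k`-classes, which the
matching keeps apart. -/
theorem TowerMatching.not_map_low (T : TowerMatching E L F M φ) (x x' p : X) (q : Y) {k : I}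
    (hk : towerDist E x x' = k) (hb : k ≠ ⊥) : ¬ M k (T.map x p q) (T.map x' p q) := by
  have hxx' : E k x x' := T.rel_of_dist hk.le
  induction hm : towerDist E x p using WellFoundedLT.induction generalizing p q with
  | ind m ih =>
  rcases le_or_gt m k with hmk | hmk
  · have hx : E k x p := T.rel_of_dist (hm.le.trans hmk)
    have hx' : E k x' p := (E k).trans ((E k).symm hxx') hx
    intro hM
    have h1 := T.map_low x p q hb (towerDist_le hx)
    have h2 := T.map_low x' p q hb (towerDist_le hx')
    have h3 : L k x x' := ((T.matching k hb p q).rel_iff x x' hx hx').2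
      ((M k).trans ((M k).symm h1) ((M k).trans hM h2))
    obtain ⟨j, hj, h4⟩ := (T.lowE k hb x x').1 h3
    exact absurd (towerDist_le h4) (not_le.2 (hk ▸ hj))
  · have hm' : towerDist E x' p = m := (T.dist_eq hxx' (hm ▸ hmk)).trans hm
    have hb' : m ≠ ⊥ := hmk.ne_bot
    have hL : L m x x' := (T.lowE m hb' _ _).2 ⟨k, hmk, hxx'⟩
    rw [T.map_step q hm hb', T.map_step q hm' hb', ← Setoid.rep_eq hL]
    refine ih _ ?_ _ _ rfl
    subst hm; exact T.dist_rep_lt hb'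

theorem TowerMatching.map_rel_map_iff (T : TowerMatching E L F M φ) (x x' p : X) (q : Y) (i : I) :
    E i x x' ↔ F i (T.map x p q) (T.map x' p q) := by
  refine ⟨T.map_rel_map x x' p q i, fun h => ?_⟩
  by_contra hE
  have hlt : i < towerDist E x x' := by
    by_contra! hle
    exact hE (T.rel_of_dist hle)
  exact T.not_map_low x x' p q rfl hlt.ne_bot (T.le_low hlt h)

/-- The descent is run backwards from y. The bound on the distance keeps x in the `L m`-class of the
chosen z, so that the descent of x passes through the same representative. -/
theorem TowerMatching.exists_map_rel (T : TowerMatching E L F M φ)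
    (onto : ∀ i ≠ ⊥, ∀ p q, IsOntoMatching (E i) (M i) (F i) p q (φ i p q)) (y : Y) (p : X)
    (q : Y) : ∃ x, F ⊥ (T.map x p q) y ∧ towerDist E x p ≤ towerDist F y q := by
  induction hm : towerDist F y q using WellFoundedLT.induction generalizing p q with
  | ind m ih =>
  by_cases hb : m = ⊥
  · have hp : towerDist E p p = ⊥ := le_bot_iff.1 (towerDist_le ((E ⊥).refl p))
    refine ⟨p, ?_, by rw [hp]; exact bot_le⟩
    rw [T.map_bot q hp]
    have := towerDist_spec T.exF y q
    rw [hm, hb] at this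
    exact (F ⊥).symm this
  · have hmat := T.matching m hb p q
    have hy : F m y q := by rw [← hm]; exact towerDist_spec T.exF y q
    obtain ⟨z, hz, hzy⟩ := onto m hb p q y hy
    have hr := (L m).rel_rep z
    have hz' : E m ((L m).rep z) p := (E m).trans ((E m).symm (T.low_le hb hr)) hz
    have h1 : M m (φ m p q ((L m).rep z)) y :=
      (M m).trans ((hmat.rel_iff _ _ hz' hz).1 ((L m).symm hr)) hzy
    obtain ⟨j, hj, h2⟩ := (T.lowF m hb _ _).1 h1
    have hlt : towerDist F y (φ m p q ((L m).rep z)) < m :=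
      (towerDist_le ((F j).symm h2)).trans_lt hj
    obtain ⟨x, hx, hxd⟩ := ih _ hlt ((L m).rep z) _ rfl
    have hxz : L m x z := (L m).trans
      ((T.lowE m hb _ _).2 ⟨_, hxd.trans_lt hlt, towerDist_spec T.exE _ _⟩) ((L m).symm hr)
    have hxp : E m x p := (E m).trans (T.low_le hb hxz) hz
    -- If x were closer to p, then by `center` y would be closer to q than m.
    have hd : towerDist E x p = m := by
      refine le_antisymm (towerDist_le hxp) ?_
      by_contra! hlt'
      have hxp' : L m x p := (T.lowE m hb x p).2 ⟨_, hlt', towerDist_spec T.exE _ _⟩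
      have h3 : M m (φ m p q z) (φ m p q p) :=
        (hmat.rel_iff z p hz ((E m).refl p)).1 ((L m).trans ((L m).symm hxz) hxp')
      have h4 : M m y q := (M m).trans ((M m).symm hzy) ((M m).trans h3 hmat.center)
      obtain ⟨j', hj', h5⟩ := (T.lowF m hb _ _).1 h4
      exact absurd (towerDist_le h5) (not_le.2 (hm ▸ hj'))
    refine ⟨x, ?_, hd.le⟩
    rw [T.map_step q hd hb, Setoid.rep_eq hxz]
    exact hx

end Tower

/-! ### Coarse embeddings and filtered balleans -/

namespace Ballean

/-- A coarse map whose inverse is coarse as well. -/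
def IsCoarseEmbedding {X : Type u} {Y : Type v} (E : Ballean X) (F : Ballean Y) (f : X → Y) :
    Prop :=
  IsCoarseMap E F f ∧ ∀ δ ∈ F.radii, ∃ ε ∈ E.radii, ∀ x y, (f x, f y) ∈ δ → (x, y) ∈ ε

theorem exists_mem_radii {X : Type u} (E : Ballean X) (x y : X) : ∃ ε ∈ E.radii, (x, y) ∈ ε := by
  have h : ((x, y) : X × X) ∈ ⋃₀ E.radii := by rw [E.sUnion_radii]; trivial
  exact h

/-- The fibres of f are uniformly bounded, so a choice of one preimage for each value is a large
set, on which f is a bijection to its image. -/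
theorem IsCoarseEmbedding.coarselyEquivalent {X : Type u} {Y : Type v} [Nonempty X]
    {E : Ballean X} {F : Ballean Y} {f : X → Y} (hf : IsCoarseEmbedding E F f)
    (hl : F.IsLarge (Set.range f)) : CoarselyEquivalent E F := by
  obtain ⟨x₀⟩ := ‹Nonempty X›
  choose s hs using fun y : Set.range f => y.2
  have hinj : ∀ y : Set.range f, f (s y) = y := hs
  refine ⟨Set.range s, Set.range f, ?_, hl, ?_⟩
  · obtain ⟨δ, hδ, -⟩ := F.exists_mem_radii (f x₀) (f x₀)
    obtain ⟨ε, hε, h⟩ := hf.2 δ hδ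
    refine ⟨ε, hε, Set.eq_univ_of_forall fun x => ?_⟩
    refine Set.mem_biUnion (Set.mem_range_self ⟨f x, x, rfl⟩) ?_
    refine h _ _ ?_
    rw [hinj ⟨f x, x, rfl⟩]
    exact (F.isEntourage δ hδ).1.refl _
  · let e : Set.range s ≃ Set.range f :=
      { toFun := fun x => ⟨f x, x, rfl⟩
        invFun := fun y => ⟨s y, y, rfl⟩
        left_inv := by
          rintro ⟨_, y, rfl⟩
          exact Subtype.ext (congrArg s (Subtype.ext (hinj y)))
        right_inv := fun y => Subtype.ext (hinj y) }
    refine ⟨e, ?_, ?_⟩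
    · rintro _ ⟨ε, hε, rfl⟩
      obtain ⟨δ, hδ, h⟩ := hf.1 ε hε
      exact ⟨_, ⟨δ, hδ, rfl⟩, fun x y hxy => h x y hxy⟩
    · rintro _ ⟨δ, hδ, rfl⟩
      obtain ⟨ε, hε, h⟩ := hf.2 δ hδ
      refine ⟨_, ⟨ε, hε, rfl⟩, fun x y hxy => h _ _ ?_⟩
      change (f (s x), f (s y)) ∈ δ
      rw [hinj, hinj]
      exact hxy

theorem IsCoarseEmbedding.coarselyEquivalent_range {X : Type u} {Y : Type v} [Nonempty X]
    {E : Ballean X} {F : Ballean Y} {f : X → Y} (hf : IsCoarseEmbedding E F f) :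
    CoarselyEquivalent E (F.sub (Set.range f)) := by
  have hg : IsCoarseEmbedding E (F.sub (Set.range f)) (Set.rangeFactorization f) := by
    refine ⟨fun ε hε => ?_, ?_⟩
    · obtain ⟨δ, hδ, h⟩ := hf.1 ε hε
      exact ⟨_, ⟨δ, hδ, rfl⟩, h⟩
    · rintro _ ⟨δ, hδ, rfl⟩
      exact hf.2 δ hδ
  refine hg.coarselyEquivalent ?_
  obtain ⟨x₀⟩ := ‹Nonempty X›
  obtain ⟨ε, hε, -⟩ := (F.sub (Set.range f)).exists_mem_radii ⟨f x₀, x₀, rfl⟩ ⟨f x₀, x₀, rfl⟩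
  refine ⟨ε, hε, Set.eq_univ_of_forall fun y => ?_⟩
  rw [Set.rangeFactorization_surjective.range_eq]
  exact Set.mem_biUnion (Set.mem_univ y)
    (((F.sub (Set.range f)).isEntourage ε hε).1.refl y)

/-- An equivalence relation contained in a radius. -/
def Bdd {X : Type u} (E : Ballean X) (S : Setoid X) : Prop :=
  ∃ ε ∈ E.radii, ∀ x y, S x y → (x, y) ∈ ε

theorem Bdd.mono {X : Type u} {E : Ballean X} {S T : Setoid X} (hT : E.Bdd T) (h : S ≤ T) :
    E.Bdd S := by
  obtain ⟨ε, hε, h'⟩ := hT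
  exact ⟨ε, hε, fun x y hxy => h' x y (h hxy)⟩

/-- The bounded equivalence relations have a cofinal family indexed by `I`, and families indexed by
proper initial segments of `I` are bounded. -/
structure IsFiltered {X : Type u} (E : Ballean X) (I : Type v) [LinearOrder I] : Prop where
  cofinal : ∃ R : I → Setoid X, (∀ i, E.Bdd (R i)) ∧
    ∀ ε ∈ E.radii, ∃ i, ∀ x y, (x, y) ∈ ε → R i x y
  directed : ∀ (i : I) (S : Set.Iio i → Setoid X), (∀ j, E.Bdd (S j)) →
    ∃ T, E.Bdd T ∧ ∀ j, S j ≤ T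

section

variable {X : Type u} {E : Ballean X} {I : Type v} [LinearOrder I]

theorem IsFiltered.exists_bdd (h : E.IsFiltered I) {ε : SetRel X X} (hε : ε ∈ E.radii) :
    ∃ T, E.Bdd T ∧ ∀ x y, (x, y) ∈ ε → T x y := by
  obtain ⟨R, hR, hc⟩ := h.cofinal
  obtain ⟨i, hi⟩ := hc ε hε
  exact ⟨R i, hR i, hi⟩

theorem IsFiltered.exists_sup (h : E.IsFiltered I) {S T : Setoid X} (hS : E.Bdd S)
    (hT : E.Bdd T) : ∃ U, E.Bdd U ∧ S ≤ U ∧ T ≤ U := by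
  obtain ⟨ε, hε, h1⟩ := hS
  obtain ⟨δ, hδ, h2⟩ := hT
  obtain ⟨η, hη, h3⟩ := E.comp_subset ε hε δ hδ
  obtain ⟨U, hU, h4⟩ := h.exists_bdd hη
  refine ⟨U, hU, fun x y hxy => h4 _ _ (h3 ⟨y, h1 _ _ hxy, ?_⟩),
    fun x y hxy => h4 _ _ (h3 ⟨x, ?_, h2 _ _ hxy⟩)⟩
  · exact (E.isEntourage δ hδ).1.refl y
  · exact (E.isEntourage ε hε).1.refl x

end

/-- The union of the relations below `k` of a monotone family of equivalence relations. -/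
def unionBelow {J : Type*} [LinearOrder J] {X : Type u} (E : J → Setoid X)
    (hE : Monotone E) (k : J) (hk : ∃ j, j < k) : Setoid X where
  r x y := ∃ j < k, E j x y
  iseqv :=
    { refl := fun x => hk.imp fun j hj => ⟨hj, (E j).refl x⟩
      symm := fun ⟨j, hj, h⟩ => ⟨j, hj, (E j).symm h⟩
      trans := fun ⟨j, hj, h⟩ ⟨j', hj', h'⟩ => ⟨max j j', max_lt hj hj',
        (E _).trans (hE (le_max_left _ _) h) (hE (le_max_right _ _) h')⟩ }

/-! ### Simultaneous construction of two towers -/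

section Build

variable {X : Type u} {Y : Type v} {I : Type*} [LinearOrder I] [WellFoundedLT I]

/-- The possible continuations of a pair of towers. -/
structure IsStage (E : Ballean X) (F : Ballean Y) (onto : Prop) (L R : Setoid X) (L' R' : Setoid Y)
    (D : Setoid X × Setoid Y) : Prop where
  bdd_fst : E.Bdd D.1
  bdd_snd : F.Bdd D.2
  le_fst : L ≤ D.1
  le_snd : L' ≤ D.2
  le_fst' : R ≤ D.1
  le_snd' : R' ≤ D.2
  matching : ∀ p q, ∃ φ, IsMatching L D.1 L' D.2 p q φ ∧ (onto → IsOntoMatching D.1 L' D.2 p q φ)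

/-- The join of `b` with the relations below `i`. -/
def joinBelow (b : Setoid X) (G : I → Setoid X) (i : I) : Setoid X := b ⊔ ⨆ j : Set.Iio i, G j

/-- A continuation exists only if the earlier relations are bounded, which is known only after the
recursion. Hence the recursion uses a default value where there is none, and the conclusion is
conditional; an induction removes the condition later. -/
theorem exists_stage_family (E : Ballean X) (F : Ballean Y) (onto : Prop) (b : Setoid X)
    (b' : Setoid Y) (R : I → Setoid X) (R' : I → Setoid Y) :
    ∃ G : I → Setoid X × Setoid Y, ∀ i,
      (∃ D, IsStage E F onto (joinBelow b (fun j => (G j).1) i) (R i)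
        (joinBelow b' (fun j => (G j).2) i) (R' i) D) →
      IsStage E F onto (joinBelow b (fun j => (G j).1) i) (R i)
        (joinBelow b' (fun j => (G j).2) i) (R' i) (G i) := by
  classical
  let step : ∀ i : I, (∀ j, j < i → Setoid X × Setoid Y) → Setoid X × Setoid Y := fun i prev =>
    if h : ∃ D, IsStage E F onto (b ⊔ ⨆ j : Set.Iio i, (prev j j.2).1) (R i)
        (b' ⊔ ⨆ j : Set.Iio i, (prev j j.2).2) (R' i) D then h.choose else (b, b')
  obtain ⟨G, hG⟩ : ∃ G : I → Setoid X × Setoid Y, ∀ i, G i = step i fun j _ => G j :=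
    ⟨wellFounded_lt.fix step, fun i => WellFounded.fix_eq _ step i⟩
  refine ⟨G, fun i h => ?_⟩
  have key : ∀ D, D = h.choose → IsStage E F onto (joinBelow b (fun j => (G j).1) i) (R i)
        (joinBelow b' (fun j => (G j).2) i) (R' i) D := by
    rintro _ rfl
    exact h.choose_spec
  exact key _ ((hG i).trans (dif_pos h))

theorem joinBelow_bdd {E : Ballean X} (hE : E.IsFiltered I) {b : Setoid X} (hb : E.Bdd b)
    (G : I → Setoid X) (i : I) (h : ∀ j < i, E.Bdd (G j)) : E.Bdd (joinBelow b G i) := by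
  obtain ⟨T, hT, hle⟩ := hE.directed i (fun j => G j) (fun j => h j j.2)
  obtain ⟨U, hU, h1, h2⟩ := hE.exists_sup hb hT
  exact hU.mono (sup_le h1 (iSup_le fun j => (hle j).trans h2))

theorem le_joinBelow (b : Setoid X) (G : I → Setoid X) {j i : I} (h : j < i) :
    G j ≤ joinBelow b G i :=
  (le_iSup (fun j : Set.Iio i => G j) ⟨j, h⟩).trans le_sup_right

/-- A family indexed by `I` together with an additional smallest element. -/
def extendBot (b : Setoid X) (G : I → Setoid X) : WithBot I → Setoid X
  | ⊥ => b
  | (i : I) => G i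

theorem extendBot_monotone {b : Setoid X} {G : I → Setoid X}
    (h : ∀ i, joinBelow b G i ≤ G i) : Monotone (extendBot b G) := by
  intro i j hij
  induction i using WithBot.recBotCoe with
  | bot =>
    induction j using WithBot.recBotCoe with
    | bot => exact le_rfl
    | coe j => exact le_sup_left.trans (h j)
  | coe i =>
    induction j using WithBot.recBotCoe with
    | bot => exact absurd hij (by simp)
    | coe j =>
      rcases (WithBot.coe_le_coe.1 hij).lt_or_eq with hlt | rfl
      · exact (le_joinBelow b G hlt).trans (h j)
      · exact le_rfl

/-- A join of equivalence relations involves chains in general; for a monotone family the union is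
already transitive. -/
theorem extendBot_joinBelow {b : Setoid X} {G : I → Setoid X}
    (h : ∀ i, joinBelow b G i ≤ G i) (i : WithBot I) (hi : i ≠ ⊥) (x y : X) :
    extendBot b (joinBelow b G) i x y ↔ ∃ j < i, extendBot b G j x y := by
  induction i using WithBot.recBotCoe with
  | bot => exact absurd rfl hi
  | coe i =>
    constructor
    · intro hxy
      have : joinBelow b G i ≤ unionBelow (extendBot b G) (extendBot_monotone h) (i : WithBot I)
          ⟨⊥, WithBot.bot_lt_coe i⟩ := by
        refine sup_le (fun x y hxy => ⟨⊥, WithBot.bot_lt_coe i, hxy⟩) (iSup_le fun j => ?_)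
        exact fun x y hxy => ⟨(j : I), WithBot.coe_lt_coe.2 j.2, hxy⟩
      exact this hxy
    · rintro ⟨j, hj, hxy⟩
      induction j using WithBot.recBotCoe with
      | bot => exact (le_sup_left : b ≤ joinBelow b G i) hxy
      | coe j => exact le_joinBelow b G (WithBot.coe_lt_coe.1 hj) hxy

/-- Two filtered balleans with matching stages admit a coarse embedding. -/
theorem exists_isCoarseEmbedding_of_stages [Nonempty X] [Nonempty Y] {E : Ballean X}
    {F : Ballean Y} (hE : E.IsFiltered I) (hF : F.IsFiltered I) (onto : Prop) {b : Setoid X}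
    {b' : Setoid Y} (hb : E.Bdd b) (hb' : F.Bdd b')
    (stage : ∀ L R L' R', E.Bdd L → E.Bdd R → F.Bdd L' → F.Bdd R' → b ≤ L → b' ≤ L' →
      ∃ D, IsStage E F onto L R L' R' D) :
    ∃ f : X → Y, IsCoarseEmbedding E F f ∧ (onto → F.IsLarge (Set.range f)) := by
  obtain ⟨x₀⟩ := ‹Nonempty X›
  obtain ⟨y₀⟩ := ‹Nonempty Y›
  obtain ⟨R, hR, hRc⟩ := hE.cofinal
  obtain ⟨R', hR', hRc'⟩ := hF.cofinal
  obtain ⟨G, hG⟩ := exists_stage_family E F onto b b' R R'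
  have hst : ∀ i, IsStage E F onto (joinBelow b (fun j => (G j).1) i) (R i)
        (joinBelow b' (fun j => (G j).2) i) (R' i) (G i) := by
    intro i
    induction i using WellFoundedLT.induction with
    | ind i ih =>
    exact hG i (stage _ _ _ _ (joinBelow_bdd hE hb _ i fun j hj => (ih j hj).bdd_fst) (hR i)
      (joinBelow_bdd hF hb' _ i fun j hj => (ih j hj).bdd_snd) (hR' i) le_sup_left le_sup_left)
  choose φ hφ hφ' using fun i => (hst i).matching
  have T : TowerMatching (extendBot b fun j => (G j).1)
      (extendBot b (joinBelow b fun j => (G j).1)) (extendBot b' fun j => (G j).2)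
      (extendBot b' (joinBelow b' fun j => (G j).2))
      (fun i => WithBot.recBotCoe (C := fun _ => X → Y → X → Y) (fun _ q _ => q) φ i) := by
    refine ⟨extendBot_monotone fun i => (hst i).le_fst, extendBot_monotone fun i => (hst i).le_snd,
      fun x y => ?_, fun x y => ?_, extendBot_joinBelow fun i => (hst i).le_fst,
      extendBot_joinBelow fun i => (hst i).le_snd, fun i hi p q => ?_⟩
    · obtain ⟨ε, hε, h⟩ := E.exists_mem_radii x y
      obtain ⟨i, hi⟩ := hRc ε hε
      exact ⟨i, (hst i).le_fst' (hi x y h)⟩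
    · obtain ⟨ε, hε, h⟩ := F.exists_mem_radii x y
      obtain ⟨i, hi⟩ := hRc' ε hε
      exact ⟨i, (hst i).le_snd' (hi x y h)⟩
    · induction i using WithBot.recBotCoe with
      | bot => exact absurd rfl hi
      | coe i => exact hφ i p q
  refine ⟨fun x => T.map x x₀ y₀, ⟨fun ε hε => ?_, fun δ hδ => ?_⟩, fun ho => ?_⟩
  · obtain ⟨i, hi⟩ := hRc ε hε
    obtain ⟨δ, hδ, h⟩ := (hst i).bdd_snd
    refine ⟨δ, hδ, fun x y hxy => h _ _ ?_⟩
    exact (T.map_rel_map_iff x y x₀ y₀ (i : WithBot I)).1 ((hst i).le_fst' (hi x y hxy))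
  · obtain ⟨i, hi⟩ := hRc' δ hδ
    obtain ⟨ε, hε, h⟩ := (hst i).bdd_fst
    refine ⟨ε, hε, fun x y hxy => h _ _ ?_⟩
    exact (T.map_rel_map_iff x y x₀ y₀ (i : WithBot I)).2 ((hst i).le_snd' (hi _ _ hxy))
  · obtain ⟨δ, hδ, h⟩ := hb'
    refine ⟨δ, hδ, Set.eq_univ_of_forall fun y => ?_⟩
    obtain ⟨x, hx, -⟩ := T.exists_map_rel (fun i hi p q => by
      induction i using WithBot.recBotCoe with
      | bot => exact absurd rfl hi
      | coe i => exact hφ' i p q ho) y x₀ y₀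
    exact Set.mem_biUnion (Set.mem_range_self x) (h _ _ hx)

end Build

end Ballean

/-! ### Counting and regrouping classes -/

/-- The `L`-classes in the `D`-class of `p`. -/
def classesIn {X : Type u} (L D : Setoid X) (p : X) : Set (Quotient L) :=
  Quotient.mk L '' {x | D x p}

section Classes

variable {X Y : Type u} {L L₁ D D₁ : Setoid X} {L' D' : Setoid Y}

theorem classesIn_mono (h : D ≤ D₁) (p : X) : classesIn L D p ⊆ classesIn L D₁ p :=
  Set.image_mono fun _ hx => h hx

theorem mk_classesIn_le_of_le (h : L ≤ L₁) (p : X) :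
    #(classesIn L₁ D p) ≤ #(classesIn L D p) := by
  have : classesIn L₁ D p = Quotient.map' id (fun _ _ hxy => h hxy) '' classesIn L D p := by
    rw [classesIn, classesIn, Set.image_image]
    rfl
  rw [this]
  exact mk_image_le

theorem mk_classesIn_ne_zero (p : X) : #(classesIn L D p) ≠ 0 := by
  rw [Cardinal.mk_ne_zero_iff]
  exact ⟨⟨_, p, D.refl p, rfl⟩⟩

theorem rel_out_of_mem_classesIn (h : L ≤ D) {p : X} {c : Quotient L}
    (hc : c ∈ classesIn L D p) : D c.out p := by
  obtain ⟨x, hx, rfl⟩ := hc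
  exact D.trans (h (Quotient.exact (Quotient.out_eq _))) hx

theorem exists_isMatching_of_injective (h' : L' ≤ D') {p : X} {q : Y}
    (e : classesIn L D p → classesIn L' D' q) (he : Function.Injective e)
    (hp : (e ⟨Quotient.mk L p, p, D.refl p, rfl⟩ : Quotient L') = Quotient.mk L' q) :
    ∃ φ, IsMatching L D L' D' p q φ ∧
      (Function.Surjective e → IsOntoMatching D L' D' p q φ) := by
  classical
  let φ : X → Y := fun x => if h : D x p then (e ⟨Quotient.mk L x, x, h, rfl⟩ : Quotient L').out
    else q
  have hφ : ∀ x (h : D x p), Quotient.mk L' (φ x) = e ⟨Quotient.mk L x, x, h, rfl⟩ := by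
    intro x h
    simp only [φ, dif_pos h]
    exact Quotient.out_eq _
  refine ⟨φ, ⟨fun x hx => ?_, fun x x' hx hx' => ?_, ?_⟩, fun hs y hy => ?_⟩
  · simp only [φ, dif_pos hx]
    exact rel_out_of_mem_classesIn h' (e _).2
  · constructor
    · intro h
      refine Quotient.exact (s := L') ?_
      rw [hφ x hx, hφ x' hx']
      congr 2
      exact Subtype.ext (Quotient.sound h)
    · intro h
      have := Quotient.sound (s := L') h
      rw [hφ x hx, hφ x' hx'] at this
      exact Quotient.exact (Subtype.ext_iff.1 (he (Subtype.ext this)))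
  · refine Quotient.exact (s := L') ?_
    rw [hφ p (D.refl p), hp]
  · obtain ⟨⟨_, x, hx, rfl⟩, h⟩ := hs ⟨_, y, hy, rfl⟩
    refine ⟨x, hx, Quotient.exact (s := L') ?_⟩
    rw [hφ x hx, h]

/-- Any injection of the classes can be followed by a transposition that sends the class of p to
that of q. -/
theorem exists_isMatching_of_le (h' : L' ≤ D') {p : X} {q : Y}
    (h : #(classesIn L D p) ≤ #(classesIn L' D' q)) : ∃ φ, IsMatching L D L' D' p q φ := by
  classical
  obtain ⟨e⟩ := h
  let p₀ : classesIn L D p := ⟨Quotient.mk L p, p, D.refl p, rfl⟩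
  let q₀ : classesIn L' D' q := ⟨Quotient.mk L' q, q, D'.refl q, rfl⟩
  obtain ⟨φ, hφ, -⟩ := exists_isMatching_of_injective h' (fun c => Equiv.swap (e p₀) q₀ (e c))
    ((Equiv.injective _).comp e.injective) (congrArg Subtype.val (Equiv.swap_apply_left (e p₀) q₀))
  exact ⟨φ, hφ⟩

theorem exists_isOntoMatching_of_eq (h' : L' ≤ D') {p : X} {q : Y}
    (h : #(classesIn L D p) = #(classesIn L' D' q)) :
    ∃ φ, IsMatching L D L' D' p q φ ∧ IsOntoMatching D L' D' p q φ := by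
  classical
  obtain ⟨e⟩ := Cardinal.eq.1 h
  let p₀ : classesIn L D p := ⟨Quotient.mk L p, p, D.refl p, rfl⟩
  let q₀ : classesIn L' D' q := ⟨Quotient.mk L' q, q, D'.refl q, rfl⟩
  obtain ⟨φ, hφ, hs⟩ := exists_isMatching_of_injective h' (e.trans (Equiv.swap (e p₀) q₀))
    (Equiv.injective _) (congrArg Subtype.val (Equiv.swap_apply_left (e p₀) q₀))
  exact ⟨φ, hφ, hs (Equiv.surjective _)⟩

/-- The classes of `D` can be grouped inside of the classes of `D₁` such that each group contains
exactly `n` of the `L`-classes. -/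
theorem exists_grouping {n : Cardinal.{u}} (hn : ℵ₀ ≤ n) (hLD : L ≤ D) (hD : D ≤ D₁)
    (h : ∀ p, #(classesIn L D p) ≤ n) (h₁ : ∀ p, n ≤ #(classesIn D D₁ p)) :
    ∃ G, D ≤ G ∧ G ≤ D₁ ∧ ∀ p, #(classesIn L G p) = n := by
  let π : Quotient D → Quotient D₁ := Quotient.map' id (fun _ _ hxy => hD hxy)
  let A : Quotient D₁ → Set (Quotient D) := fun c => {d | π d = c}
  have hA : ∀ c, n ≤ #(A c) := by
    intro c
    induction c using Quotient.inductionOn with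
    | h p =>
    refine (h₁ p).trans (mk_le_mk_of_subset ?_)
    rintro _ ⟨x, hx, rfl⟩
    exact Quotient.sound hx
  have hn0 : n ≠ 0 := (aleph0_pos.trans_le hn).ne'
  -- Since |A c| · n = |A c|, the set A c splits into groups of size n named by the elements of A c;
  -- below, g d is the name of the group of d.
  have he : ∀ c, Nonempty (A c ≃ A c × n.out) := by
    intro c
    rw [← Cardinal.eq, mk_prod, Cardinal.lift_id, Cardinal.lift_id, mk_out,
      mul_eq_left (hn.trans (hA c)) (hA c) hn0]
  let e : ∀ c, A c ≃ A c × n.out := fun c => (he c).some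
  let g : Quotient D → Quotient D := fun d => (e (π d) ⟨d, rfl⟩).1
  have hπg : ∀ d, π (g d) = π d := fun d => (e (π d) ⟨d, rfl⟩).1.2
  have hg : ∀ d, #{d' | g d' = g d} = n := by
    intro d
    obtain ⟨c, hc⟩ : ∃ c, π d = c := ⟨_, rfl⟩
    have hgd : g d ∈ A c := (hπg d).trans hc
    have key : ∀ d' (h' : π d' = c), g d' = (e c ⟨d', h'⟩).1 := by
      rintro d' rfl
      rfl
    rw [← mk_out n]
    refine (Cardinal.mk_congr ?_).symm
    let f : n.out → {d' | g d' = g d} := fun t => ⟨(e c).symm (⟨g d, hgd⟩, t), by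
      rw [Set.mem_setOf_eq, key _ ((e c).symm (⟨g d, hgd⟩, t)).2]
      simp⟩
    refine Equiv.ofBijective f ⟨fun t t' htt' => ?_, ?_⟩
    · have h1 : ((e c).symm (⟨g d, hgd⟩, t) : Quotient D) = (e c).symm (⟨g d, hgd⟩, t') :=
        congrArg (fun z : {d' | g d' = g d} => (z : Quotient D)) htt'
      exact (Prod.ext_iff.1 ((e c).symm.injective (Subtype.ext h1))).2
    · rintro ⟨d', hd'⟩
      have h' : π d' = c := by rw [← hπg d', hd', hπg d, hc]
      refine ⟨(e c ⟨d', h'⟩).2, Subtype.ext ?_⟩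
      change ((e c).symm (⟨g d, hgd⟩, (e c ⟨d', h'⟩).2) : Quotient D) = d'
      have : (⟨g d, hgd⟩, (e c ⟨d', h'⟩).2) = e c ⟨d', h'⟩ := by
        refine Prod.ext (Subtype.ext ?_) rfl
        rw [← key d' h']
        exact hd'.symm
      rw [this]
      simp
  let G : Setoid X := Setoid.ker fun x => g (Quotient.mk D x)
  have hG : D ≤ G := fun x y hxy => congrArg g (Quotient.sound hxy)
  refine ⟨G, hG, fun x y hxy => ?_, fun p => le_antisymm ?_ ?_⟩
  · have h1 : π (g (Quotient.mk D x)) = π (g (Quotient.mk D y)) := congrArg π hxy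
    rw [hπg, hπg] at h1
    exact Quotient.exact h1
  · have hsub : classesIn L G p ⊆
        ⋃ d ∈ {d' | g d' = g (Quotient.mk D p)}, classesIn L D d.out := by
      rintro _ ⟨x, hx, rfl⟩
      refine Set.mem_biUnion (x := Quotient.mk D x) hx ⟨x, ?_, rfl⟩
      exact D.symm (Quotient.exact (Quotient.out_eq _))
    refine (mk_le_mk_of_subset hsub).trans ((mk_biUnion_le _ _).trans ?_)
    rw [hg]
    calc n * _ ≤ n * n := mul_le_mul_right (ciSup_le' fun d => h _) n
      _ = n := mul_eq_self hn
  -- Lower bound: the n different D-classes of a group contain different L-classes.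
  · rw [← hg (Quotient.mk D p)]
    refine mk_le_of_injective (f := fun d => ⟨Quotient.mk L d.1.out, d.1.out, ?_, rfl⟩) ?_
    · change g (Quotient.mk D d.1.out) = g (Quotient.mk D p)
      rw [Quotient.out_eq]
      exact d.2
    · intro d d' hdd'
      have : L d.1.out d'.1.out := Quotient.exact (Subtype.ext_iff.1 hdd')
      refine Subtype.ext ?_
      rw [← Quotient.out_eq d.1, ← Quotient.out_eq d'.1]
      exact Quotient.sound (hLD this)

end Classes

/-! ### Covering numbers and embeddings -/

namespace Ballean

variable {X Y : Type u} {E : Ballean X} {F : Ballean Y}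

/-- Each ε-ball lies in one L-class, so different classes need different centres. -/
theorem mk_classesIn_le_cov {ε δ : SetRel X X} {L D : Setoid X} (hε₀ : ∀ x, (x, x) ∈ ε)
    (hε : ∀ x y, (x, y) ∈ ε → L x y) (hδ : ∀ x y, D x y → (x, y) ∈ δ) (p : X) :
    #(classesIn L D p) ≤ cov ε (ball p δ) := by
  have hne : {c | ∃ C : Set X, ball p δ ⊆ nhd C ε ∧ #C = c}.Nonempty :=
    ⟨_, Set.univ, fun y _ => Set.mem_biUnion (Set.mem_univ y) (hε₀ y), rfl⟩
  obtain ⟨C, hC, hcard⟩ := csInf_mem hne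
  rw [cov, ← hcard]
  have : classesIn L D p ⊆ Quotient.mk L '' C := by
    rintro _ ⟨x, hx, rfl⟩
    obtain ⟨a, ha, hax⟩ := Set.mem_iUnion₂.1 (hC (hδ p x (D.symm hx)))
    exact ⟨a, ha, Quotient.sound (hε _ _ hax)⟩
  exact (mk_le_mk_of_subset this).trans mk_image_le

theorem cov_le_mk_classesIn {ε δ : SetRel X X} {L D : Setoid X} (hε : ∀ x y, L x y → (x, y) ∈ ε)
    (hδ : ∀ x y, (x, y) ∈ δ → D x y) (p : X) : cov ε (ball p δ) ≤ #(classesIn L D p) := by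
  have hC : ball p δ ⊆ nhd (Quotient.out '' classesIn L D p) ε := by
    intro x hx
    refine Set.mem_biUnion (s := Quotient.out '' classesIn L D p)
      ⟨Quotient.mk L x, ⟨x, D.symm (hδ _ _ hx), rfl⟩, rfl⟩ ?_
    exact hε _ _ (Quotient.exact (Quotient.out_eq _))
  exact (csInf_le' (s := {c | ∃ C : Set X, ball p δ ⊆ nhd C ε ∧ #C = c})
    ⟨_, hC, rfl⟩).trans mk_image_le

variable {I : Type*} [LinearOrder I]

/-- The number of `b`-classes in bounded classes is bounded below `covSharp`. -/
theorem IsFiltered.exists_forall_le [Nonempty X] (hE : E.IsFiltered I) :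
    ∃ b, E.Bdd b ∧ ∀ D, E.Bdd D → ∃ n < E.covSharp, ∀ p, #(classesIn b D p) ≤ n := by
  have hne : {κ : Cardinal.{u} | ∃ ε ∈ E.radii, ∀ δ ∈ E.radii,
      ⨆ x : X, cov ε (ball x δ) < κ}.Nonempty := by
    obtain ⟨x₀⟩ := ‹Nonempty X›
    obtain ⟨ε, hε, -⟩ := E.exists_mem_radii x₀ x₀
    refine ⟨Order.succ #X, ε, hε, fun δ hδ => Order.lt_succ_of_le (ciSup_le' fun x => ?_)⟩
    refine csInf_le' ⟨Set.univ, fun y _ => ?_, mk_univ⟩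
    exact Set.mem_biUnion (Set.mem_univ y) ((E.isEntourage ε hε).1.refl y)
  obtain ⟨ε, hε, h⟩ := csInf_mem hne
  obtain ⟨b, hb, hεb⟩ := hE.exists_bdd hε
  refine ⟨b, hb, fun D ⟨δ, hδ, hD⟩ => ⟨_, h δ hδ, fun p => ?_⟩⟩
  refine (mk_classesIn_le_cov (E.isEntourage ε hε).1.refl hεb hD p).trans ?_
  exact le_ciSup (f := fun x => cov ε (ball x δ)) bddAbove_of_small p

/-- Bounded relations with many classes in each class exist up to `covFlat`. -/
theorem IsFiltered.exists_forall_ge [Nonempty X] (hE : E.IsFiltered I) {L : Setoid X}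
    (hL : E.Bdd L) {n : Cardinal.{u}} (hn : n < E.covFlat) :
    ∃ D, E.Bdd D ∧ ∀ p, n ≤ #(classesIn L D p) := by
  obtain ⟨ε, hε, hLε⟩ := hL
  obtain ⟨δ, hδ, h⟩ := (covFlat_isGreatest E).1 n hn ε hε
  obtain ⟨D, hD, hδD⟩ := hE.exists_bdd hδ
  refine ⟨D, hD, fun p => ?_⟩
  exact (h.trans (ciInf_le' _ p)).trans (cov_le_mk_classesIn hLε hδD p)

/-- Passing from b to a coarser L only lowers the number of classes, so the bound n for b works at
every stage. As n is below `covFlat` of the target, the target can be coarsened to have at least n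
classes. -/
theorem exists_isCoarseEmbedding [Nonempty X] [Nonempty Y] [WellFoundedLT I]
    (hE : E.IsFiltered I) (hF : F.IsFiltered I) (h : E.covSharp ≤ F.covFlat) :
    ∃ f : X → Y, IsCoarseEmbedding E F f := by
  obtain ⟨b, hb, hbn⟩ := hE.exists_forall_le
  obtain ⟨b', hb', -⟩ := hF.exists_forall_le
  refine (exists_isCoarseEmbedding_of_stages hE hF False hb hb' ?_).imp fun f hf => hf.1
  intro L R L' R' hL hR hL' hR' hbL _
  obtain ⟨D, hD, hLD, hRD⟩ := hE.exists_sup hL hR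
  obtain ⟨n, hn, hDn⟩ := hbn D hD
  obtain ⟨D₁, hD₁, hn₁⟩ := hF.exists_forall_ge hL' (hn.trans_le h)
  obtain ⟨D₂, hD₂, hLD₂, hRD₂⟩ := hF.exists_sup hL' hR'
  obtain ⟨D', hD', h1, h2⟩ := hF.exists_sup hD₁ hD₂
  refine ⟨(D, D'), hD, hD', hLD, hLD₂.trans h2, hRD, hRD₂.trans h2, fun p q => ?_⟩
  obtain ⟨φ, hφ⟩ := exists_isMatching_of_le (L := L) (D := D) (hLD₂.trans h2)
    ((((mk_classesIn_le_of_le hbL p).trans (hDn p)).trans (hn₁ q)).trans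
      (mk_le_mk_of_subset (classesIn_mono h1 q)))
  exact ⟨φ, hφ, False.elim⟩

theorem IsFiltered.exists_grouping [Nonempty X] (hE : E.IsFiltered I) {L D : Setoid X}
    (hD : E.Bdd D) (hLD : L ≤ D) {n : Cardinal.{u}} (hn₀ : ℵ₀ ≤ n) (hn : n < E.covFlat)
    (h : ∀ p, #(classesIn L D p) ≤ n) :
    ∃ G, E.Bdd G ∧ D ≤ G ∧ ∀ p, #(classesIn L G p) = n := by
  obtain ⟨D₁, hD₁, hn₁⟩ := hE.exists_forall_ge hD hn
  obtain ⟨D₂, hD₂, h1, h2⟩ := hE.exists_sup hD hD₁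
  obtain ⟨G, hDG, hG, hGn⟩ := _root_.exists_grouping hn₀ hLD h1 h
    (fun p => (hn₁ p).trans (mk_le_mk_of_subset (classesIn_mono h2 p)))
  exact ⟨G, hD₂.mono hG, hDG, hGn⟩

theorem exists_isCoarseEmbedding_isLarge [Nonempty X] [Nonempty Y] [WellFoundedLT I]
    (hE : E.IsFiltered I) (hF : F.IsFiltered I) {κ : Cardinal.{u}} (hκ : ℵ₀ < κ)
    (h₁ : E.covSharp ≤ κ) (h₂ : κ ≤ E.covFlat) (h₃ : F.covSharp ≤ κ) (h₄ : κ ≤ F.covFlat) :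
    ∃ f : X → Y, IsCoarseEmbedding E F f ∧ F.IsLarge (Set.range f) := by
  obtain ⟨b, hb, hbn⟩ := hE.exists_forall_le
  obtain ⟨b', hb', hbn'⟩ := hF.exists_forall_le
  refine (exists_isCoarseEmbedding_of_stages hE hF True hb hb' ?_).imp
    fun f hf => ⟨hf.1, hf.2 trivial⟩
  intro L R L' R' hL hR hL' hR' hbL hbL'
  obtain ⟨D, hD, hLD, hRD⟩ := hE.exists_sup hL hR
  obtain ⟨D', hD', hLD', hRD'⟩ := hF.exists_sup hL' hR'
  obtain ⟨n, hn, hDn⟩ := hbn D hD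
  obtain ⟨n', hn', hDn'⟩ := hbn' D' hD'
  -- The common class count must be infinite for the regrouping and below κ; uncountability of κ is
  -- used only here.
  have hm : max (max n n') ℵ₀ < κ := max_lt (max_lt (hn.trans_le h₁) (hn'.trans_le h₃)) hκ
  obtain ⟨G, hG, hDG, hGn⟩ := hE.exists_grouping hD hLD (le_max_right _ _) (hm.trans_le h₂)
    (fun p => ((mk_classesIn_le_of_le hbL p).trans (hDn p)).trans
      ((le_max_left n n').trans (le_max_left _ _)))
  obtain ⟨G', hG', hDG', hGn'⟩ := hF.exists_grouping hD' hLD' (le_max_right _ _)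
    (hm.trans_le h₄) (fun p => ((mk_classesIn_le_of_le hbL' p).trans (hDn' p)).trans
      ((le_max_right n n').trans (le_max_left _ _)))
  refine ⟨(G, G'), hG, hG', hLD.trans hDG, hLD'.trans hDG', hRD.trans hDG, hRD'.trans hDG',
    fun p q => ?_⟩
  obtain ⟨φ, hφ, hφ'⟩ := exists_isOntoMatching_of_eq (L := L) (D := G) (hLD'.trans hDG')
    ((hGn p).trans (hGn' q).symm)
  exact ⟨φ, hφ, fun _ => hφ'⟩

end Ballean

/-! ### Cellular ordinal balleans are filtered -/

namespace Ballean

section Ordinal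

variable {X : Type u} {E : Ballean X}

theorem radius_mem_coarseStructure {ε : SetRel X X} (hε : ε ∈ E.radii) :
    ε ∈ E.coarseStructure := ⟨E.isEntourage ε hε, ε, hε, subset_rfl⟩

theorem exists_isBase_mk_eq_cof (E : Ballean X) : ∃ B, E.IsBase B ∧ #B = E.cof :=
  csInf_mem (s := {c | ∃ B : Set (SetRel X X), E.IsBase B ∧ #B = c})
    ⟨_, E.coarseStructure, ⟨subset_rfl, fun δ hδ => ⟨δ, hδ, subset_rfl⟩⟩, rfl⟩

theorem cof_le_of_isBase {B : Set (SetRel X X)} (hB : E.IsBase B) : E.cof ≤ #B :=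
  csInf_le' (s := {c | ∃ B : Set (SetRel X X), E.IsBase B ∧ #B = c}) ⟨B, hB, rfl⟩

theorem IsCellular.exists_bdd (h : E.IsCellular) {δ : SetRel X X} (hδ : δ ∈ E.coarseStructure) :
    ∃ T, E.Bdd T ∧ ∀ x y, (x, y) ∈ δ → T x y := by
  obtain ⟨B, hB, ht⟩ := h
  obtain ⟨ε, hε, hδε⟩ := hB.2 δ hδ
  obtain ⟨⟨hr, hs⟩, η, hη, hεη⟩ := hB.1 hε
  exact ⟨⟨fun x y => (x, y) ∈ ε, hr.refl, hs.symm _ _, (ht ε hε).trans _ _ _⟩,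
    ⟨η, hη, fun x y hxy => hεη hxy⟩, fun x y hxy => hδε hxy⟩

theorem IsOrdinal.isFiltered (hord : E.IsOrdinal) (hcell : E.IsCellular) :
    E.IsFiltered E.cof.ord.ToType where
  cofinal := by
    obtain ⟨C, hC, hcard⟩ := E.exists_isBase_mk_eq_cof
    obtain ⟨e⟩ : Nonempty (E.cof.ord.ToType ≃ C) := by
      rw [← Cardinal.eq, hcard, mk_ord_toType]
    choose R hR hRe using fun i => hcell.exists_bdd (hC.1 (e i).2)
    refine ⟨R, hR, fun ε hε => ?_⟩
    obtain ⟨c, hc, h⟩ := hC.2 ε (radius_mem_coarseStructure hε)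
    refine ⟨e.symm ⟨c, hc⟩, fun x y hxy => hRe _ x y ?_⟩
    rw [e.apply_symm_apply]
    exact h hxy
  directed := by
    intro i S hS
    obtain ⟨κ, B, hBm, hBr, hB⟩ := hord
    choose ε hε hSε using hS
    have h : ∀ j, ∃ a, ε j ⊆ B a := fun j => by
      obtain ⟨_, ⟨a, rfl⟩, ha⟩ := hB.2 _ (radius_mem_coarseStructure (hε j))
      exact ⟨a, ha⟩
    choose a ha using h
    by_cases hb : ∃ α, ∀ j, a j ≤ α
    · obtain ⟨α, hα⟩ := hb
      obtain ⟨T, hT, hBT⟩ := hcell.exists_bdd (hB.1 ⟨α, rfl⟩)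
      exact ⟨T, hT, fun j x y hxy => hBT x y (hBm (hα j) (ha j (hSε j x y hxy)))⟩
    · exfalso
      push Not at hb
      -- Unbounded indices in the ordinal base would yield a base with fewer than `E.cof` elements.
      have hbase : E.IsBase (Set.range fun j => B (a j)) := by
        refine ⟨?_, fun δ hδ => ?_⟩
        · rintro _ ⟨j, rfl⟩
          exact hB.1 ⟨a j, rfl⟩
        · obtain ⟨_, ⟨α, rfl⟩, hα⟩ := hB.2 δ hδ
          obtain ⟨j, hj⟩ := hb α
          exact ⟨_, ⟨j, rfl⟩, hα.trans (hBm hj.le)⟩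
      exact absurd ((cof_le_of_isBase hbase).trans mk_range_le)
        (not_le.2 (mk_Iio_toType_ord_lt i))

theorem exists_radius_univ_of_cof_eq_one (h : E.cof = 1) :
    ∃ ε ∈ E.radii, ∀ x y, (x, y) ∈ ε := by
  obtain ⟨C, hC, hcard⟩ := E.exists_isBase_mk_eq_cof
  rw [h, mk_set_eq_one_iff] at hcard
  obtain ⟨c, rfl⟩ := hcard
  obtain ⟨-, ε, hε, hcε⟩ := hC.1 rfl
  refine ⟨ε, hε, fun x y => ?_⟩
  obtain ⟨δ, hδ, hxy⟩ := E.exists_mem_radii x y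
  obtain ⟨_, rfl, hδc⟩ := hC.2 δ (radius_mem_coarseStructure hδ)
  exact hcε (hδc hxy)

theorem exists_isCoarseEmbedding_of_univ {Y : Type v} {F : Ballean Y} [Nonempty Y]
    (hE : ∃ ε ∈ E.radii, ∀ x y, (x, y) ∈ ε) (hF : ∃ ε ∈ F.radii, ∀ x y, (x, y) ∈ ε) [Nonempty X] :
    ∃ f : X → Y, IsCoarseEmbedding E F f ∧ F.IsLarge (Set.range f) := by
  obtain ⟨ε, hε, hεu⟩ := hE
  obtain ⟨δ, hδ, hδu⟩ := hF
  obtain ⟨x₀⟩ := ‹Nonempty X›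
  obtain ⟨y₀⟩ := ‹Nonempty Y›
  refine ⟨fun _ => y₀, ⟨fun _ _ => ⟨δ, hδ, fun _ _ _ => hδu _ _⟩,
    fun _ _ => ⟨ε, hε, fun _ _ _ => hεu _ _⟩⟩, δ, hδ, Set.eq_univ_of_forall fun y => ?_⟩
  exact Set.mem_biUnion (Set.mem_range_self x₀) (hδu y₀ y)

end Ordinal

/-! ### The Cantor macro-cube -/

section Cube

/-- The entourages of the macro-cube are equivalence relations. -/
def cubeSetoid {γ : Ordinal.{u}} (β : γ.ToType) : Setoid (γ.ToType →₀ Fin 2) where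
  r x y := (x, y) ∈ cubeEntourage β
  iseqv :=
    { refl := fun _ _ _ => rfl
      symm := fun h α hα => (h α hα).symm
      trans := fun h h' α hα => (h α hα).trans (h' α hα) }

theorem cubeEntourage_mono {γ : Ordinal.{u}} {β β' : γ.ToType} (h : β ≤ β') :
    cubeEntourage β ⊆ cubeEntourage β' := fun _ hp α hα => hp α (h.trans_lt hα)

variable {γ : Ordinal.{u}} (hγ : γ ≠ 0)

theorem cubeSetoid_bdd (β : γ.ToType) : (cantorMacroCube γ hγ).Bdd (cubeSetoid β) :=
  ⟨_, ⟨β, rfl⟩, fun _ _ h => h⟩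

theorem cantorMacroCube_isFiltered : (cantorMacroCube γ hγ).IsFiltered γ.cof.ord.ToType where
  cofinal := by
    obtain ⟨s, hs, hcard⟩ := Order.exists_cof_eq γ.ToType
    rw [Ordinal.cof_toType] at hcard
    obtain ⟨e⟩ : Nonempty (γ.cof.ord.ToType ≃ s) := by
      rw [← Cardinal.eq, hcard, mk_ord_toType]
    refine ⟨fun i => cubeSetoid (e i : γ.ToType), fun i => cubeSetoid_bdd hγ _, ?_⟩
    rintro _ ⟨β, rfl⟩
    obtain ⟨b, hb, hle⟩ := hs β
    refine ⟨e.symm ⟨b, hb⟩, fun x y hxy => ?_⟩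
    change (x, y) ∈ cubeEntourage (e (e.symm ⟨b, hb⟩) : γ.ToType)
    rw [e.apply_symm_apply]
    exact cubeEntourage_mono hle hxy
  directed := by
    intro i S hS
    have h : ∀ j, ∃ β : γ.ToType, ∀ x y, S j x y → (x, y) ∈ cubeEntourage β := by
      intro j
      obtain ⟨_, ⟨β, rfl⟩, h⟩ := hS j
      exact ⟨β, h⟩
    choose β hβ using h
    have hnc : ¬ IsCofinal (Set.range β) := fun hc => by
      have := (Order.cof_le hc).trans mk_range_le
      rw [Ordinal.cof_toType] at this
      exact absurd this (not_le.2 (mk_Iio_toType_ord_lt i))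
    rw [IsCofinal] at hnc
    push Not at hnc
    obtain ⟨α, hα⟩ := hnc
    exact ⟨cubeSetoid α, cubeSetoid_bdd hγ α, fun j x y hxy =>
      cubeEntourage_mono (hα _ ⟨j, rfl⟩).le (hβ j x y hxy)⟩

theorem exists_radius_univ_cantorMacroCube (h : γ.cof = 1) :
    ∃ ε ∈ (cantorMacroCube γ hγ).radii, ∀ x y, (x, y) ∈ ε := by
  rw [← Ordinal.cof_toType, Order.cof_eq_one_iff] at h
  obtain ⟨b, hb⟩ := h
  exact ⟨_, ⟨b, rfl⟩, fun x y α hα => absurd (hb α) (not_le.2 hα)⟩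

theorem exists_le_add_cardinalTail (γ : Ordinal.{u}) (hγ : γ ≠ 0) :
    ∃ β < γ, γ ≤ β + (cardinalTail γ).ord := by
  refine csInf_mem (s := {α : Ordinal.{u} | ∃ β < γ, γ ≤ β + α.card.ord})
    ⟨(Order.succ γ.card).ord, 0, pos_iff_ne_zero.2 hγ, ?_⟩
  rw [card_ord, zero_add]
  exact (lt_ord.2 (Order.lt_succ _)).le

theorem add_lt_of_lt_cardinalTail {μ : Cardinal.{u}} (h : μ < cardinalTail γ) {β : Ordinal.{u}}
    (hβ : β < γ) : β + μ.ord < γ := by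
  by_contra! hle
  have : sInf {α : Ordinal.{u} | ∃ β < γ, γ ≤ β + α.card.ord} ≤ μ.ord :=
    csInf_le' ⟨β, hβ, by rwa [card_ord]⟩
  have := Ordinal.card_le_card this
  rw [card_ord] at this
  exact absurd h (not_lt.2 this)

theorem aleph0_le_cardinalTail (h : Order.IsSuccLimit γ) : ℵ₀ ≤ cardinalTail γ := by
  by_contra! hlt
  obtain ⟨β, hβ, hle⟩ := exists_le_add_cardinalTail γ h.ne_bot
  obtain ⟨n, hn⟩ := lt_aleph0.1 hlt
  rw [hn, ord_natCast] at hle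
  refine absurd hle (not_le.2 ?_)
  clear hle hn
  induction n with
  | zero => simpa using hβ
  | succ n ih =>
    rw [Nat.cast_succ, ← add_assoc]
    exact h.succ_lt ih

/-- Here γ = β + ω for some β. -/
theorem cof_eq_aleph0_of_cardinalTail (h : Order.IsSuccLimit γ) (ht : cardinalTail γ = ℵ₀) :
    γ.cof = ℵ₀ := by
  obtain ⟨β, hβ, hle⟩ := exists_le_add_cardinalTail γ h.ne_bot
  rw [ht, ord_aleph0] at hle
  have : γ = β + Ordinal.omega0 := by
    refine le_antisymm hle ?_
    refine (Ordinal.add_le_iff_of_isSuccLimit Ordinal.isSuccLimit_omega0).2 fun ξ hξ => ?_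
    obtain ⟨n, rfl⟩ := Ordinal.lt_omega0.1 hξ
    have := add_lt_of_lt_cardinalTail (μ := n) (ht ▸ natCast_lt_aleph0) hβ
    rw [ord_natCast] at this
    exact this.le
  rw [this, Ordinal.cof_add _ Ordinal.omega0_ne_zero, Ordinal.cof_omega0]

theorem mk_finsupp_lt {S : Type u} {κ : Cardinal.{u}} (hκ : ℵ₀ ≤ κ) (h : #S < κ) :
    #(S →₀ Fin 2) < κ := by
  rcases finite_or_infinite S with hS | hS
  · exact (mk_lt_aleph0_iff.2 (Finite.of_injective _ DFunLike.coe_injective)).trans_le hκ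
  · rw [mk_finsupp_lift_of_infinite]
    simp only [lift_uzero, mk_fin, lift_natCast]
    exact max_lt h (natCast_lt_aleph0.trans_le hκ)

/-- Choose β₀ with γ ≤ β₀ + ⌈γ⌉. Modulo the coordinates up to β₀, a ball of radius c is determined
by the coordinates in (β₀, c]. These are fewer than ⌈γ⌉, and hence so are the finitely supported
functions on them. -/
theorem covSharp_cantorMacroCube_le (h : Order.IsSuccLimit γ) :
    (cantorMacroCube γ hγ).covSharp ≤ cardinalTail γ := by
  obtain ⟨β₀, hβ₀, hle⟩ := exists_le_add_cardinalTail γ hγ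
  let b : γ.ToType := Ordinal.ToType.mk ⟨β₀, hβ₀⟩
  have hκ := aleph0_le_cardinalTail h
  refine csInf_le' ⟨cubeEntourage b, ⟨b, rfl⟩, ?_⟩
  rintro _ ⟨c, rfl⟩
  have hS : #(Set.Ioc b c) < cardinalTail γ := by
    rcases le_or_gt b c with hle' | hlt
    swap
    · rw [Set.Ioc_eq_empty_of_le hlt.le]
      simpa using aleph0_pos.trans_le hκ
    let t : γ.ToType → Ordinal.{u} := fun a => (Ordinal.ToType.mk.symm a : Set.Iio γ)
    have ht : StrictMono t := fun a a' haa' => Ordinal.ToType.mk.symm.strictMono haa'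
    have htγ : ∀ a, t a < γ := fun a => (Ordinal.ToType.mk.symm a).2
    have htb : t b = β₀ := by simp [t, b]
    have hbc : β₀ ≤ t c := htb ▸ ht.monotone hle'
    have hξ : t c - β₀ < (cardinalTail γ).ord := by
      rw [← add_lt_add_iff_left β₀, Ordinal.add_sub_cancel_of_le hbc]
      exact (htγ c).trans_le hle
    -- The successor accounts for the endpoint c of the interval.
    have hξ' : Order.succ (t c - β₀) < (cardinalTail γ).ord :=
      (isSuccLimit_ord hκ).succ_lt hξ
    refine lt_of_le_of_lt ?_ (lt_ord.1 hξ')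
    rw [← mk_toType]
    refine mk_le_of_injective (f := fun a => Ordinal.ToType.mk ⟨t a - β₀, ?_⟩) ?_
    · exact Order.lt_succ_of_le (Ordinal.sub_le.2 <| by
        rw [Ordinal.add_sub_cancel_of_le hbc]
        exact ht.monotone a.2.2)
    · intro a a' haa'
      have h1 := congrArg Subtype.val (Ordinal.ToType.mk.injective haa')
      have h2 : β₀ ≤ t a := htb ▸ (ht a.2.1).le
      have h3 : β₀ ≤ t a' := htb ▸ (ht a'.2.1).le
      refine Subtype.ext (ht.injective ?_)
      rw [← Ordinal.add_sub_cancel_of_le h2, ← Ordinal.add_sub_cancel_of_le h3]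
      exact congrArg _ h1
  refine lt_of_le_of_lt (ciSup_le' fun x => ?_) (mk_finsupp_lt hκ hS)
  have hC : ball x (cubeEntourage c) ⊆
      nhd {y | ∀ a ∉ Set.Ioc b c, y a = x a} (cubeEntourage b) := by
    intro z hz
    refine Set.mem_biUnion
      (x := z.filter (· ∈ Set.Ioc b c) + x.filter (· ∉ Set.Ioc b c)) (fun a ha => ?_) fun a ha => ?_
    · rw [Finsupp.add_apply, Finsupp.filter_apply, Finsupp.filter_apply, if_neg ha, if_pos ha,
        zero_add]
    · rw [Finsupp.add_apply, Finsupp.filter_apply, Finsupp.filter_apply]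
      by_cases h : a ∈ Set.Ioc b c
      · rw [if_pos h, if_neg (not_not.2 h), add_zero]
      · rw [if_neg h, if_pos h, zero_add]
        exact hz a (not_le.1 fun h' => h ⟨ha, h'⟩)
  refine (csInf_le' (s := {k | ∃ C : Set (γ.ToType →₀ Fin 2),
    ball x (cubeEntourage c) ⊆ nhd C (cubeEntourage b) ∧ #C = k}) ⟨_, hC, rfl⟩).trans ?_
  refine mk_le_of_injective (f := fun y => y.1.subtypeDomain (· ∈ Set.Ioc b c)) ?_
  intro y y' hyy'
  refine Subtype.ext (Finsupp.ext fun a => ?_)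
  by_cases ha : a ∈ Set.Ioc b c
  · exact DFunLike.congr_fun hyy' (⟨a, ha⟩ : Set.Ioc b c)
  · rw [y.2 a ha, y'.2 a ha]

/-- For μ < ⌈γ⌉ there are μ coordinates between b and β + μ < γ. Changing x at one of them at a time
gives μ points, no two in a common ball of radius b. -/
theorem le_covFlat_cantorMacroCube : cardinalTail γ ≤ (cantorMacroCube γ hγ).covFlat := by
  refine (covFlat_isGreatest _).2 ?_
  rintro μ hμ _ ⟨b, rfl⟩
  have hb : ((Ordinal.ToType.mk.symm b : Set.Iio γ) : Ordinal.{u}) < γ :=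
    (Ordinal.ToType.mk.symm b).2
  let β : Ordinal.{u} := (Ordinal.ToType.mk.symm b : Set.Iio γ)
  have hβμ : β + μ.ord < γ := add_lt_of_lt_cardinalTail hμ hb
  refine ⟨_, ⟨Ordinal.ToType.mk ⟨β + μ.ord, hβμ⟩, rfl⟩, le_ciInf fun x => ?_⟩
  let s : μ.ord.ToType → Ordinal.{u} := fun t => (Ordinal.ToType.mk.symm t : Set.Iio μ.ord)
  -- Successors keep the changed coordinates strictly above b, where the radius b sees them.
  have hs : ∀ t, β + Order.succ (s t) ≤ β + μ.ord := fun t =>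
    add_le_add_right (Order.succ_le_of_lt (Ordinal.ToType.mk.symm t).2) β
  let p : μ.ord.ToType → γ.ToType := fun t =>
    Ordinal.ToType.mk ⟨β + Order.succ (s t), (hs t).trans_lt hβμ⟩
  have hbp : ∀ t, b < p t := by
    intro t
    rw [← Ordinal.ToType.mk.symm.lt_iff_lt, OrderIso.symm_apply_apply]
    exact lt_add_of_pos_right _ (zero_le.trans_lt (Order.lt_succ (s t)))
  have hp : Function.Injective p := by
    intro t t' htt'
    have h1 := congrArg Subtype.val (Ordinal.ToType.mk.injective htt')
    have h2 : s t = s t' := Order.succ_injective (add_left_cancel h1)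
    exact Ordinal.ToType.mk.symm.injective (Subtype.ext h2)
  refine le_csInf ⟨_, Set.univ, fun y _ => Set.mem_biUnion (Set.mem_univ y) fun _ _ => rfl, rfl⟩ ?_
  rintro _ ⟨C, hC, rfl⟩
  have hy : ∀ t, ∃ c ∈ C, (c, x.update (p t) (x (p t) + 1)) ∈ cubeEntourage b := by
    intro t
    have : x.update (p t) (x (p t) + 1) ∈
        ball x (cubeEntourage (Ordinal.ToType.mk ⟨β + μ.ord, hβμ⟩)) := by
      intro a ha
      have hne : a ≠ p t := by
        rintro rfl
        exact absurd (Ordinal.ToType.mk.lt_iff_lt.1 ha) (not_lt.2 (hs t))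
      simp [Finsupp.update, hne]
    obtain ⟨c, hc, h⟩ := Set.mem_iUnion₂.1 (hC this)
    exact ⟨c, hc, h⟩
  choose c hcC hc using hy
  rw [← mk_ord_toType μ]
  refine mk_le_of_injective (f := fun t => (⟨c t, hcC t⟩ : C)) fun t t' htt' => ?_
  by_contra hne
  have h1 := hc t (p t) (hbp t)
  have h2 := hc t' (p t) (hbp t)
  have h3 : c t = c t' := congrArg Subtype.val htt'
  have h4 : p t ≠ p t' := fun h => hne (hp h)
  simp only [h3, Finsupp.coe_update, Function.update_self, Function.update_of_ne h4] at h1 h2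
  rw [h2] at h1
  simp at h1

end Cube

end Ballean

/-! ### Bi-Lipschitz maps of the line -/

/-- `φ` distorts distances on `B` by a factor of at most `l` and it preserves the order. -/
def IsBilipschitzOn (l : ℝ) (φ : ℕ → ℝ) (B : Set ℕ) : Prop :=
  ∀ b ∈ B, ∀ b' ∈ B, b ≤ b' →
    ((b' : ℝ) - b ≤ l * (φ b' - φ b) ∧ φ b' - φ b ≤ l * ((b' : ℝ) - b))

/-- The inverse of a monotone bi-Lipschitz map extends to a monotone bi-Lipschitz map. -/
theorem exists_isBilipschitzOn_inverse {l : ℝ} (hl : 1 ≤ l) {C : Set ℕ} (h0 : 0 ∈ C) {ψ : ℕ → ℕ}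
    (hψ0 : ψ 0 = 0) (hψ : IsBilipschitzOn l (fun c => ψ c) C) :
    ∃ I : ℕ → ℝ, IsBilipschitzOn l I Set.univ ∧ ∀ c ∈ C, I (ψ c) = c := by
  have hl0 : 0 < l := by linarith
  -- This sublinear kernel has slope l on the right and 1/l on the left. The McShane infimum formed
  -- with it below therefore obeys the upper and the lower estimate at once.
  let k : ℝ → ℝ := fun t => max (l * t) (t / l)
  have hk : ∀ s t, k (s + t) ≤ k s + k t := by
    intro s t
    refine max_le ?_ ?_
    · rw [mul_add]
      exact add_le_add (le_max_left _ _) (le_max_left _ _)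
    · rw [add_div]
      exact add_le_add (le_max_right _ _) (le_max_right _ _)
  have hdiv : ∀ t : ℝ, 0 ≤ t → t / l ≤ l * t := by
    intro t ht
    rw [div_le_iff₀ hl0]
    nlinarith [mul_nonneg (mul_nonneg (sub_nonneg.2 hl) ht) (by linarith : (0 : ℝ) ≤ l + 1)]
  have hkpos : ∀ t, 0 ≤ t → k t = l * t := fun t ht => max_eq_left (hdiv t ht)
  have hkneg : ∀ t, 0 ≤ t → k (-t) = -(t / l) := by
    intro t ht
    simp only [k]
    rw [max_eq_right]
    · ring
    · have := hdiv t ht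
      rw [neg_div]
      linarith
  have hkey : ∀ c ∈ C, ∀ c' ∈ C, (c : ℝ) ≤ c' + k ((ψ c : ℝ) - ψ c') := by
    intro c hc c' hc'
    rcases le_total c' c with h | h
    · have := (hψ c' hc' c hc h).1
      have h2 : l * ((ψ c : ℝ) - ψ c') ≤ k ((ψ c : ℝ) - ψ c') := le_max_left _ _
      linarith
    · have := (hψ c hc c' hc' h).2
      have h2 : ((ψ c : ℝ) - ψ c') / l ≤ k ((ψ c : ℝ) - ψ c') := le_max_right _ _
      have h3 : -((c' : ℝ) - c) ≤ ((ψ c : ℝ) - ψ c') / l := by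
        rw [le_div_iff₀ hl0]
        linarith
      linarith
  let h : ℕ → C → ℝ := fun b c => (c : ℕ) + k ((b : ℝ) - ψ c)
  have hbdd : ∀ b, BddBelow (Set.range (h b)) := by
    intro b
    refine ⟨-(k (-(b : ℝ))), ?_⟩
    rintro _ ⟨c, rfl⟩
    have h1 := hkey 0 h0 c c.2
    have h2 := hk ((b : ℝ) - ψ c) (-(b : ℝ))
    have h3 : (b : ℝ) - ψ c + -(b : ℝ) = (ψ 0 : ℝ) - ψ c := by rw [hψ0]; push_cast; ring
    rw [h3] at h2
    simp only [h]
    push_cast at h1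
    linarith
  have : Nonempty C := ⟨⟨0, h0⟩⟩
  have hI : ∀ b b' : ℕ, (⨅ c, h b' c) ≤ (⨅ c, h b c) + k ((b' : ℝ) - b) := by
    intro b b'
    rw [← sub_le_iff_le_add]
    refine le_ciInf fun c => ?_
    rw [sub_le_iff_le_add]
    refine (ciInf_le (hbdd b') c).trans ?_
    have h2 := hk ((b : ℝ) - ψ c) ((b' : ℝ) - b)
    have h3 : (b : ℝ) - ψ c + ((b' : ℝ) - b) = (b' : ℝ) - ψ c := by ring
    rw [h3] at h2
    simp only [h]
    linarith
  refine ⟨fun b => ⨅ c, h b c, fun b _ b' _ hbb' => ⟨?_, ?_⟩, fun c hc => le_antisymm ?_ ?_⟩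
  · have h1 := hI b' b
    have hb : (0 : ℝ) ≤ (b' : ℝ) - b := sub_nonneg.2 (by exact_mod_cast hbb')
    rw [← neg_sub (b' : ℝ) b, hkneg _ hb] at h1
    have h2 : ((b' : ℝ) - b) / l ≤ (⨅ c, h b' c) - ⨅ c, h b c := by linarith
    rw [div_le_iff₀ hl0] at h2
    linarith
  · have h1 := hI b b'
    have hb : (0 : ℝ) ≤ (b' : ℝ) - b := sub_nonneg.2 (by exact_mod_cast hbb')
    rw [hkpos _ hb] at h1
    linarith
  · refine (ciInf_le (hbdd _) ⟨c, hc⟩).trans ?_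
    simp [h, k]
  · exact le_ciInf fun c' => hkey c hc c' c'.2

open Classical in
/-- The largest element of `A` below `n`. -/
noncomputable def roundDown (A : Set ℕ) (n : ℕ) : ℕ := Nat.findGreatest (· ∈ A) n

theorem roundDown_le (A : Set ℕ) (n : ℕ) : roundDown A n ≤ n := by
  classical
  unfold roundDown
  exact Nat.findGreatest_le n

theorem roundDown_mem {A : Set ℕ} (h0 : 0 ∈ A) (n : ℕ) : roundDown A n ∈ A := by
  classical
  unfold roundDown
  exact Nat.findGreatest_spec (P := (· ∈ A)) (Nat.zero_le n) h0

theorem le_roundDown_iff {A : Set ℕ} {p n : ℕ} (hp : p ∈ A) : p ≤ roundDown A n ↔ p ≤ n := by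
  classical
  refine ⟨fun h => h.trans (roundDown_le A n), fun h => ?_⟩
  unfold roundDown
  exact Nat.le_findGreatest h hp

theorem roundDown_of_mem {A : Set ℕ} {n : ℕ} (hn : n ∈ A) : roundDown A n = n :=
  le_antisymm (roundDown_le A n) ((le_roundDown_iff hn).2 le_rfl)

/-- Rounding a bi-Lipschitz map to a dense set, on a sparse set. -/
theorem exists_isBilipschitzOn_round {e : ℝ} (he0 : 0 < e) (he1 : e ≤ 1) {I : ℕ → ℝ}
    (hI : IsBilipschitzOn (1 + e / 2) I Set.univ) (hI0 : I 0 = 0) {A B : Set ℕ} {s : ℕ}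
    (hA0 : 0 ∈ A) (hA : ∀ n, ∃ p ∈ A, p ≤ n ∧ n < p + s)
    (hB : ∀ p ∈ B, ∀ q ∈ B, p < q → (8 : ℝ) * s ≤ e * ((q : ℝ) - p)) :
    ∃ φ : ℕ → ℕ, IsBilipschitzOn (1 + e) (fun b => φ b) B ∧ (∀ b, φ b ∈ A) ∧
      ∀ b, ∀ a ∈ A, I b = a → φ b = a := by
  have hIpos : ∀ b, 0 ≤ I b := by
    intro b
    have := (hI 0 trivial b trivial (Nat.zero_le b)).1
    rw [hI0] at this
    push_cast at this
    by_contra! hneg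
    have h1 : (1 + e / 2) * I b < 0 := mul_neg_of_pos_of_neg (by linarith) hneg
    have h2 : (0 : ℝ) ≤ b := Nat.cast_nonneg b
    linarith
  refine ⟨fun b => roundDown A ⌊I b⌋₊, ?_, fun b => roundDown_mem hA0 _, fun b a ha hb => ?_⟩
  swap
  · simp only [hb, Nat.floor_natCast]
    exact roundDown_of_mem ha
  have h1 : ∀ b, ((roundDown A ⌊I b⌋₊ : ℕ) : ℝ) ≤ I b := fun b =>
    (Nat.cast_le.2 (roundDown_le A _)).trans (Nat.floor_le (hIpos b))
  have h2 : ∀ b, I b ≤ (roundDown A ⌊I b⌋₊ : ℕ) + s := by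
    intro b
    obtain ⟨p, hp, hpn, hn⟩ := hA ⌊I b⌋₊
    have h3 : ⌊I b⌋₊ + 1 ≤ roundDown A ⌊I b⌋₊ + s := by
      have := (le_roundDown_iff hp).2 hpn
      omega
    have h4 : ((⌊I b⌋₊ + 1 : ℕ) : ℝ) ≤ (roundDown A ⌊I b⌋₊ + s : ℕ) := Nat.cast_le.2 h3
    push_cast at h4
    exact (Nat.lt_floor_add_one (I b)).le.trans h4
  intro b hb b' hb' hle
  rcases hle.eq_or_lt with rfl | hlt
  · simp
  have h3 := hB b hb b' hb' hlt
  obtain ⟨h4, h5⟩ := hI b trivial b' trivial hle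
  have h6 := h1 b
  have h7 := h2 b
  have h8 := h1 b'
  have h9 := h2 b'
  have hs : (0 : ℝ) ≤ s := Nat.cast_nonneg s
  have hd : (0 : ℝ) < (b' : ℝ) - b := sub_pos.2 (by exact_mod_cast hlt)
  beta_reduce
  generalize (b' : ℝ) - b = d at *
  generalize ((roundDown A ⌊I b⌋₊ : ℕ) : ℝ) = r at *
  generalize ((roundDown A ⌊I b'⌋₊ : ℕ) : ℝ) = r' at *
  constructor
  · have h10 : I b' - I b ≤ (r' - r) + s := by linarith
    have h11 : d ≤ (1 + e / 2) * ((r' - r) + s) :=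
      h4.trans (mul_le_mul_of_nonneg_left h10 (by linarith))
    -- Rounding costs at most s ≤ ed/8, and 1 + e/2 ≤ 3/2. The loss 3ed/16 is covered by the gain of
    -- at least ed/4 from replacing e/2 by e.
    have h12 : (1 + e / 2) * s ≤ 3 / 16 * (e * d) := by nlinarith
    have h13 : (1 + e / 2) * (r' - r) ≥ d - 3 / 16 * (e * d) := by linarith
    have h14 : r' - r ≥ d / 2 := by
      have : e * d ≤ d := by nlinarith
      nlinarith
    have h15 : e * (d / 2) ≤ e * (r' - r) := mul_le_mul_of_nonneg_left h14 he0.le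
    have h16 : 0 < e * d := mul_pos he0 hd
    linear_combination h13 + h15 / 2 + h16 / 16
  · have h16 : 0 < e * d := mul_pos he0 hd
    linarith

/-- An ultrafilter containing a finite set is principal; this is the compactness used for the limit
of the transfers. -/
theorem exists_eventually_eq_of_le {U : Ultrafilter ℕ} {f : ℕ → ℕ} {N : ℕ}
    (h : ∀ᶠ J in (U : Filter ℕ), f J ≤ N) : ∃ v, ∀ᶠ J in (U : Filter ℕ), f J = v := by
  obtain ⟨v, -, hv⟩ := Ultrafilter.eq_pure_of_finite_mem (f := U.map f) (Set.finite_Iic N) h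
  refine ⟨v, ?_⟩
  have : ({v} : Set ℕ) ∈ U.map f := by rw [hv]; exact Set.mem_singleton v
  exact this

/-! ### Back-and-forth between sparse sets -/

/-- The sets `C i` are subsets of a line for even `i` and of another line for odd `i`, they are
decreasing on each line, and they become sparse quickly. -/
structure IsSparseSequence (C : ℕ → Set ℕ) (s : ℕ → ℕ) : Prop where
  zero_mem : ∀ i, 0 ∈ C i
  subset : ∀ i, C (i + 2) ⊆ C i
  dense : ∀ i n, ∃ p ∈ C i, p ≤ n ∧ n < p + s i
  sparse : ∀ i, ∀ p ∈ C (i + 1), ∀ q ∈ C (i + 1), p < q → p + 2 ^ (i + 3) * s i ≤ q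

/-- A bi-Lipschitz map from `C (i + 1)` to `C i`, with a constant close to `1`. -/
structure IsTransfer (C : ℕ → Set ℕ) (i : ℕ) (φ : ℕ → ℕ) : Prop where
  mem : ∀ c, φ c ∈ C i
  zero : φ 0 = 0
  bilipschitz : IsBilipschitzOn (1 + (1 / 2) ^ i) (fun c => φ c) (C (i + 1))

section Sparse

variable {C : ℕ → Set ℕ} {s : ℕ → ℕ}

/-- With e = 2⁻ⁱ the gap 2^(i+3) · s i is 8 · s i / e, as the rounding lemma demands. -/
theorem IsSparseSequence.exists_isTransfer_of_isBilipschitzOn (hC : IsSparseSequence C s) (i : ℕ)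
    {I : ℕ → ℝ} (hI : IsBilipschitzOn (1 + (1 / 2) ^ (i + 1)) I Set.univ) (hI0 : I 0 = 0) :
    ∃ φ, IsTransfer C i φ ∧ ∀ b, ∀ a ∈ C i, I b = a → φ b = a := by
  have he : ((1 : ℝ) / 2) ^ (i + 1) = (1 / 2) ^ i / 2 := by rw [pow_succ]; ring
  rw [he] at hI
  obtain ⟨φ, h1, h2, h3⟩ := exists_isBilipschitzOn_round (e := (1 / 2) ^ i) (by positivity)
    (pow_le_one₀ (by norm_num) (by norm_num)) hI hI0 (A := C i) (B := C (i + 1)) (s := s i)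
    (hC.zero_mem i) (hC.dense i) (fun p hp q hq hpq => by
      have h : ((p + 2 ^ (i + 3) * s i : ℕ) : ℝ) ≤ q := Nat.cast_le.2 (hC.sparse i p hp q hq hpq)
      push_cast at h
      have h' : (2 : ℝ) ^ (i + 3) * s i ≤ q - p := by linarith
      have h'' := mul_le_mul_of_nonneg_left h' (by positivity : (0 : ℝ) ≤ (1 / 2) ^ i)
      refine le_trans (le_of_eq ?_) h''
      rw [← mul_assoc, pow_add, ← mul_assoc, ← mul_pow]
      norm_num)
  exact ⟨φ, ⟨h2, h3 0 0 (hC.zero_mem i) (by simpa using hI0), h1⟩, h3⟩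

theorem IsSparseSequence.exists_isTransfer_inverse (hC : IsSparseSequence C s) {i : ℕ} {ψ : ℕ → ℕ}
    (hψ : IsTransfer C (i + 1) ψ) :
    ∃ φ, IsTransfer C i φ ∧ ∀ c ∈ C (i + 2), φ (ψ c) = c := by
  have hl : (1 : ℝ) ≤ 1 + (1 / 2) ^ (i + 1) := le_add_of_nonneg_right (by positivity)
  obtain ⟨I, hI, hIψ⟩ := exists_isBilipschitzOn_inverse hl (hC.zero_mem (i + 2)) hψ.zero
    hψ.bilipschitz
  have hI0 : I 0 = 0 := by
    have := hIψ 0 (hC.zero_mem _)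
    rw [hψ.zero] at this
    simpa using this
  obtain ⟨φ, hφ, h⟩ := hC.exists_isTransfer_of_isBilipschitzOn i hI hI0
  exact ⟨φ, hφ, fun c hc => h _ _ (hC.subset i hc) (hIψ c hc)⟩

/-- Downward induction from the rounded identity at level J: each transfer is an extended and
rounded inverse of the next one. Every step doubles the excess of the Lipschitz constant over 1, so
level i has 1 + 2⁻ⁱ regardless of J. -/
theorem IsSparseSequence.exists_finite_transfers (hC : IsSparseSequence C s) (J k i : ℕ)
    (h : i + k = J) : ∃ φ : ℕ → ℕ → ℕ, ∀ j, i ≤ j → j ≤ J → IsTransfer C j (φ j) ∧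
      (j < J → ∀ c ∈ C (j + 2), φ j (φ (j + 1) c) = c) := by
  induction k generalizing i with
  | zero =>
    obtain ⟨φ, hφ, -⟩ := hC.exists_isTransfer_of_isBilipschitzOn J (I := fun n => n) (by
      intro b _ b' _ hb
      have hb' : (0 : ℝ) ≤ (b' : ℝ) - b := sub_nonneg.2 (by exact_mod_cast hb)
      have : ((b' : ℝ) - b) ≤ (1 + (1 / 2) ^ (J + 1)) * ((b' : ℝ) - b) :=
        le_mul_of_one_le_left hb' (le_add_of_nonneg_right (by positivity))
      exact ⟨this, this⟩) (by simp)
    refine ⟨fun _ => φ, fun j hj hj' => ?_⟩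
    obtain rfl : j = J := by omega
    exact ⟨hφ, fun h => absurd h (lt_irrefl _)⟩
  | succ k ih =>
    obtain ⟨φ, hφ⟩ := ih (i + 1) (by omega)
    obtain ⟨φ₀, h₀, h₀'⟩ := hC.exists_isTransfer_inverse (hφ (i + 1) le_rfl (by omega)).1
    refine ⟨Function.update φ i φ₀, fun j hj hj' => ?_⟩
    rcases hj.eq_or_lt with rfl | hlt
    · rw [Function.update_self, Function.update_of_ne (by omega)]
      exact ⟨h₀, fun _ => h₀'⟩
    · rw [Function.update_of_ne (by omega), Function.update_of_ne (by omega)]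
      exact hφ j hlt hj'

theorem IsSparseSequence.exists_transfers (hC : IsSparseSequence C s) :
    ∃ φ : ℕ → ℕ → ℕ, ∀ i, StrictMonoOn (φ i) (C (i + 1)) ∧ (∀ c ∈ C (i + 1), φ i c ∈ C i) ∧
      ∀ c ∈ C (i + 2), φ i (φ (i + 1) c) = c := by
  choose Φ hΦ using fun J => hC.exists_finite_transfers J J 0 (zero_add J)
  let U : Ultrafilter ℕ := Filter.hyperfilter ℕ
  have hU : ∀ i, ∀ᶠ J in (U : Filter ℕ), i < J := fun i =>
    Nat.hyperfilter_le_atTop (Filter.eventually_gt_atTop i)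
  have hlim : ∀ i c, ∃ v, c ∈ C (i + 1) → ∀ᶠ J in (U : Filter ℕ), Φ J i c = v := by
    intro i c
    by_cases hc : c ∈ C (i + 1)
    -- All constants are at most 2 and 0 is fixed, so the values at c are at most 2c for all large
    -- J.
    · obtain ⟨v, hv⟩ := exists_eventually_eq_of_le (U := U) (f := fun J => Φ J i c) (N := 2 * c) (by
        filter_upwards [hU i] with J hJ
        have hT := (hΦ J i (Nat.zero_le i) hJ.le).1
        have h1 := (hT.bilipschitz 0 (hC.zero_mem _) c hc (Nat.zero_le c)).2
        beta_reduce at h1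
        rw [hT.zero] at h1
        have h2 : ((1 : ℝ) / 2) ^ i ≤ 1 := pow_le_one₀ (by norm_num) (by norm_num)
        have h3 : (0 : ℝ) ≤ c := Nat.cast_nonneg c
        have h4 : (Φ J i c : ℝ) ≤ 2 * c := by
          simp only [Nat.cast_zero, sub_zero] at h1
          nlinarith
        exact_mod_cast h4)
      exact ⟨v, fun _ => hv⟩
    · exact ⟨0, fun h => absurd h hc⟩
  choose φ hφ using hlim
  have hmem : ∀ i, ∀ c ∈ C (i + 1), φ i c ∈ C i := by
    intro i c hc
    obtain ⟨J, hJ, hJi⟩ := ((hφ i c hc).and (hU i)).exists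
    rw [← hJ]
    exact (hΦ J i (Nat.zero_le i) hJi.le).1.mem c
  refine ⟨φ, fun i => ⟨fun c hc c' hc' hlt => ?_, hmem i, fun c hc => ?_⟩⟩
  · obtain ⟨J, ⟨hJ, hJ'⟩, hJi⟩ := (((hφ i c hc).and (hφ i c' hc')).and (hU i)).exists
    rw [← hJ, ← hJ']
    have h1 := ((hΦ J i (Nat.zero_le i) hJi.le).1.bilipschitz c hc c' hc' hlt.le).1
    have h2 : (0 : ℝ) < (c' : ℝ) - c := sub_pos.2 (by exact_mod_cast hlt)
    have h3 : (0 : ℝ) < (Φ J i c' : ℝ) - Φ J i c :=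
      pos_of_mul_pos_right (h2.trans_le h1) (by positivity)
    exact_mod_cast sub_pos.1 h3
  · have hv := hmem (i + 1) c hc
    obtain ⟨J, ⟨hJ, hJ'⟩, hJi⟩ := (((hφ (i + 1) c hc).and (hφ i _ hv)).and (hU i)).exists
    have := (hΦ J i (Nat.zero_le i) hJi.le).2 hJi c hc
    rw [hJ, hJ'] at this
    exact this

/-- The limit of the transfer maps respects the sets of all levels. -/
theorem IsSparseSequence.exists_transfer (hC : IsSparseSequence C s) :
    ∃ φ : ℕ → ℕ, StrictMonoOn φ (C 1) ∧ ∀ k, (∀ c ∈ C (2 * k + 1), φ c ∈ C (2 * k)) ∧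
      ∀ p ∈ C (2 * k + 2), ∃ d ∈ C (2 * k + 1), φ d = p := by
  obtain ⟨φ, hφ⟩ := hC.exists_transfers
  have hsub : ∀ i k, C (i + 2 * k) ⊆ C i := by
    intro i k
    induction k with
    | zero => exact subset_rfl
    | succ k ih => exact (hC.subset (i + 2 * k)).trans ih
  -- From c = φ (i+1) (φ (i+2) c) it follows that φ i c = φ (i+2) c: the inverse of an inverse is
  -- the map itself, so all even levels restrict φ 0.
  have heq : ∀ i k, ∀ c ∈ C (i + 2 * k + 1), φ i c = φ (i + 2 * k) c := by
    intro i k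
    induction k with
    | zero => exact fun c _ => rfl
    | succ k ih =>
      intro c hc
      have hc' : c ∈ C (i + 2 * k + 2 + 1) := hc
      rw [ih c (hC.subset _ hc')]
      have h1 := (hφ (i + 2 * k + 2)).2.1 c hc'
      have h2 := (hφ (i + 2 * k + 1)).2.2 c hc'
      have h3 := (hφ (i + 2 * k)).2.2 _ h1
      rw [h2] at h3
      exact h3
  refine ⟨φ 0, (hφ 0).1, fun k => ⟨fun c hc => ?_, fun p hp => ?_⟩⟩
  · rw [heq 0 k c (by simpa using hc)]
    have := (hφ (2 * k)).2.1 c hc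
    simpa using this
  · refine ⟨φ (2 * k + 1) p, (hφ (2 * k + 1)).2.1 p hp, ?_⟩
    have h1 := heq 1 k p (by rwa [add_comm 1 (2 * k)])
    rw [add_comm 1 (2 * k)] at h1
    rw [← h1]
    exact (hφ 0).2.2 p (hsub 2 k (by rwa [add_comm 2 (2 * k)]))

end Sparse

/-! ### Balleans represented by lines -/

/-- A tower of equivalence relations is represented by a map to the natural numbers and by sets of
cutting points. -/
structure IsLine {X : Type u} (E : ℕ → Setoid X) (π : X → ℕ) (P : ℕ → Set ℕ) : Prop where
  surjective : Function.Surjective π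
  zero_mem : ∀ i, 0 ∈ P i
  antitone : Antitone P
  rel_iff : ∀ i x y, E i x y ↔ ∀ p ∈ P i, (p ≤ π x ↔ p ≤ π y)
  dense : ∀ i, ∃ s, ∀ n, ∃ p ∈ P i, p ≤ n ∧ n < p + s
  sparse : ∀ N, ∃ i, ∀ p ∈ P i, ∀ q ∈ P i, p < q → p + N ≤ q

theorem exists_isSparseSequence {A B : ℕ → Set ℕ} (hA0 : ∀ i, 0 ∈ A i) (hB0 : ∀ i, 0 ∈ B i)
    (hA : Antitone A) (hB : Antitone B)
    (hAd : ∀ i, ∃ s, ∀ n, ∃ p ∈ A i, p ≤ n ∧ n < p + s)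
    (hBd : ∀ i, ∃ s, ∀ n, ∃ p ∈ B i, p ≤ n ∧ n < p + s)
    (hAs : ∀ N, ∃ i, ∀ p ∈ A i, ∀ q ∈ A i, p < q → p + N ≤ q)
    (hBs : ∀ N, ∃ i, ∀ p ∈ B i, ∀ q ∈ B i, p < q → p + N ≤ q) :
    ∃ (t : ℕ → ℕ) (C : ℕ → Set ℕ) (s : ℕ → ℕ), StrictMono t ∧ IsSparseSequence C s ∧
      ∀ k, C (2 * k) = B (t (2 * k)) ∧ C (2 * k + 1) = A (t (2 * k + 1)) := by
  let D : ℕ → ℕ → Set ℕ := fun i => if Even i then B else A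
  have hD0 : ∀ i j, 0 ∈ D i j := by
    intro i j
    by_cases h : Even i
    · simp only [D, if_pos h, hB0]
    · simp only [D, if_neg h, hA0]
  have hD : ∀ i, Antitone (D i) := by
    intro i
    by_cases h : Even i
    · simp only [D, if_pos h, hB]
    · simp only [D, if_neg h, hA]
  have hDd : ∀ i j, ∃ s, ∀ n, ∃ p ∈ D i j, p ≤ n ∧ n < p + s := by
    intro i j
    by_cases h : Even i
    · simp only [D, if_pos h]
      exact hBd j
    · simp only [D, if_neg h]
      exact hAd j
  have hDs : ∀ i N, ∃ j, ∀ p ∈ D i j, ∀ q ∈ D i j, p < q → p + N ≤ q := by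
    intro i N
    by_cases h : Even i
    · simp only [D, if_pos h]
      exact hBs N
    · simp only [D, if_neg h]
      exact hAs N
  have hD2 : ∀ i, D (i + 2) = D i := by
    intro i
    simp only [D, Nat.even_add, even_two, iff_true]
  choose s hs using hDd
  choose j hj using hDs
  let t : ℕ → ℕ := fun n =>
    Nat.rec 0 (fun i ti => max (ti + 1) (j (i + 1) (2 ^ (i + 3) * s i ti))) n
  have ht : ∀ i, t (i + 1) = max (t i + 1) (j (i + 1) (2 ^ (i + 3) * s i (t i))) := fun _ => rfl
  have htm : StrictMono t := strictMono_nat_of_lt_succ fun i => by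
    rw [ht]
    exact (Nat.lt_succ_self _).trans_le (le_max_left _ _)
  refine ⟨t, fun i => D i (t i), fun i => s i (t i), htm, ⟨fun i => hD0 _ _, fun i => ?_,
    fun i => hs i (t i), fun i p hp q hq => ?_⟩, fun k => ⟨?_, ?_⟩⟩
  · rw [hD2]
    exact hD i (htm.monotone (Nat.le_add_right i 2))
  · have hsub : D (i + 1) (t (i + 1)) ⊆ D (i + 1) (j (i + 1) (2 ^ (i + 3) * s i (t i))) := by
      rw [ht]
      exact hD _ (le_max_right _ _)
    exact hj _ _ p (hsub hp) q (hsub hq)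
  · simp [D]
  · simp [D]

namespace Ballean

/-- The transfer φ sends cutting points of X to cutting points of Y, and its images contain the next
thinner set for Y. Since d ≤ π x is equivalent to φ d ≤ ρ (f x), separation by cuts passes in both
directions with a shift of one level. -/
theorem exists_isCoarseEmbedding_of_isLine {X : Type u} {Y : Type v} {E : Ballean X}
    {F : Ballean Y} {R : ℕ → Setoid X} {S : ℕ → Setoid Y} {π : X → ℕ} {ρ : Y → ℕ}
    {A B : ℕ → Set ℕ} (hR : ∀ i, E.Bdd (R i)) (hS : ∀ i, F.Bdd (S i)) (hRm : Monotone R)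
    (hSm : Monotone S) (hRc : ∀ ε ∈ E.radii, ∃ i, ∀ x y, (x, y) ∈ ε → R i x y)
    (hSc : ∀ ε ∈ F.radii, ∃ i, ∀ x y, (x, y) ∈ ε → S i x y)
    (hA : IsLine R π A) (hB : IsLine S ρ B) :
    ∃ f : X → Y, IsCoarseEmbedding E F f ∧ F.IsLarge (Set.range f) := by
  obtain ⟨t, C, s, ht, hC, hCk⟩ := exists_isSparseSequence hA.zero_mem hB.zero_mem hA.antitone
    hB.antitone hA.dense hB.dense hA.sparse hB.sparse
  obtain ⟨φ, hφ, hφC⟩ := hC.exists_transfer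
  choose σ hσ using hB.surjective
  have hsub : ∀ k, C (2 * k + 1) ⊆ C 1 := by
    intro k
    rw [(hCk k).2, show C 1 = A (t 1) from (hCk 0).2]
    exact hA.antitone (ht.monotone (by omega))
  let r : X → ℕ := fun x => roundDown (C 1) (π x)
  have hr : ∀ x, r x ∈ C 1 := fun x => roundDown_mem (hC.zero_mem 1) _
  let f : X → Y := fun x => σ (φ (r x))
  have hf : ∀ x, ρ (f x) = φ (r x) := fun x => hσ _
  have hfle : ∀ d ∈ C 1, ∀ x, φ d ≤ ρ (f x) ↔ d ≤ π x := by
    intro d hd x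
    rw [hf, hφ.le_iff_le hd (hr x)]
    exact le_roundDown_iff hd
  refine ⟨f, ⟨fun ε hε => ?_, fun δ hδ => ?_⟩, ?_⟩
  · obtain ⟨i, hi⟩ := hRc ε hε
    obtain ⟨δ, hδ, h⟩ := hS (t (2 * (i + 1)))
    refine ⟨δ, hδ, fun x y hxy => h _ _ ?_⟩
    have h1 : R (t (2 * i + 1)) x y :=
      hRm ((by omega : i ≤ 2 * i + 1).trans ht.le_apply) (hi x y hxy)
    rw [hA.rel_iff, ← (hCk i).2] at h1
    rw [hB.rel_iff, ← (hCk (i + 1)).1]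
    intro p hp
    obtain ⟨d, hd, rfl⟩ := (hφC i).2 p hp
    rw [hfle d (hsub i hd), hfle d (hsub i hd)]
    exact h1 d hd
  · obtain ⟨i, hi⟩ := hSc δ hδ
    obtain ⟨ε, hε, h⟩ := hR (t (2 * i + 1))
    refine ⟨ε, hε, fun x y hxy => h _ _ ?_⟩
    have h1 : S (t (2 * i)) (f x) (f y) :=
      hSm ((by omega : i ≤ 2 * i).trans ht.le_apply) (hi _ _ hxy)
    rw [hB.rel_iff, ← (hCk i).1] at h1
    rw [hA.rel_iff, ← (hCk i).2]
    intro d hd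
    rw [← hfle d (hsub i hd), ← hfle d (hsub i hd)]
    exact h1 _ ((hφC i).1 d hd)
  · obtain ⟨δ, hδ, h⟩ := hS (t 2)
    refine ⟨δ, hδ, Set.eq_univ_of_forall fun y => ?_⟩
    -- A point over the last cut c with φ c ≤ ρ y has an image that no cut in C 2 separates from y.
    have hfin : {c | c ∈ C 1 ∧ φ c ≤ ρ y}.Finite :=
      Set.Finite.of_injOn (f := φ) (t := Set.Iic (ρ y)) (fun c hc => hc.2)
        (hφ.injOn.mono fun c hc => hc.1) (Set.finite_Iic _)
    obtain ⟨d₀, hd₀, hd₀'⟩ := (hφC 0).2 0 (hC.zero_mem 2)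
    obtain ⟨c, hc, hmax⟩ := hfin.exists_maximal
      ⟨d₀, hd₀, by rw [hd₀']; exact Nat.zero_le _⟩
    obtain ⟨x, hx⟩ := hA.surjective c
    refine Set.mem_biUnion (Set.mem_range_self x) (h _ _ ?_)
    have hC2 : C 2 = B (t 2) := (hCk 1).1
    rw [hB.rel_iff, ← hC2]
    intro p hp
    obtain ⟨d, hd, rfl⟩ := (hφC 0).2 p hp
    rw [hfle d hd, hx]
    constructor
    · intro hdc
      exact ((hφ.le_iff_le hd hc.1).2 hdc).trans hc.2
    · intro hdy
      rcases le_total d c with hle | hle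
      · exact hle
      · exact hmax ⟨hd, hdy⟩ hle

end Ballean

/-! ### Construction of a line from a tower of finite type -/

section Construction

variable {X : Type u}

/-- The data for the construction of a line: `o k` enumerates the `E k`-classes within each
`E (k + 1)`-class by numbers below `N k`, starting with the class of `x₀`. -/
structure IsLabelling (E : ℕ → Setoid X) (x₀ : X) (N : ℕ → ℕ) (o : ℕ → X → ℕ) : Prop where
  congr : ∀ k x y, E k x y → o k x = o k y
  rel : ∀ k x y, E (k + 1) x y → o k x = o k y → E k x y
  lt : ∀ k x, o k x < N k
  zero : ∀ k x, E k x x₀ → o k x = 0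

/-- The position of a point in its class of level `k`. -/
def labelPos (N : ℕ → ℕ) (o : ℕ → X → ℕ) (x : X) : ℕ → ℕ
  | 0 => 0
  | k + 1 => labelPos N o x k + (∏ i ∈ Finset.range k, N i) * o k x

variable {E : ℕ → Setoid X} {x₀ : X} {N : ℕ → ℕ} {o : ℕ → X → ℕ}

theorem IsLabelling.pos (h : IsLabelling E x₀ N o) (k : ℕ) : 0 < N k :=
  (Nat.zero_le _).trans_lt (h.lt k x₀)

theorem IsLabelling.prod_pos (h : IsLabelling E x₀ N o) (k : ℕ) :
    0 < ∏ i ∈ Finset.range k, N i := Finset.prod_pos fun i _ => h.pos i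

theorem IsLabelling.labelPos_lt (h : IsLabelling E x₀ N o) (x : X) (k : ℕ) :
    labelPos N o x k < ∏ i ∈ Finset.range k, N i := by
  induction k with
  | zero => simp [labelPos]
  | succ k ih =>
    rw [labelPos, Finset.prod_range_succ]
    have h1 := h.lt k x
    generalize ∏ i ∈ Finset.range k, N i = M at *
    calc labelPos N o x k + M * o k x < M + M * o k x := by omega
      _ = M * (o k x + 1) := by ring
      _ ≤ M * N k := Nat.mul_le_mul_left M h1

/-- `labelPos` is a mixed-radix number with digits `o`; dividing by the product of the first i
radices deletes the digits below level i. -/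
theorem IsLabelling.rel_iff_div (h : IsLabelling E x₀ N o) (hE : Monotone E) {i k : ℕ} (hik : i ≤ k)
    {x y : X} (hxy : E k x y) : E i x y ↔
      labelPos N o x k / (∏ j ∈ Finset.range i, N j) =
        labelPos N o y k / (∏ j ∈ Finset.range i, N j) := by
  induction k, hik using Nat.le_induction with
  | base =>
    rw [Nat.div_eq_of_lt (h.labelPos_lt x i), Nat.div_eq_of_lt (h.labelPos_lt y i)]
    simp [hxy]
  | succ k hik ih =>
    obtain ⟨Q, hQ⟩ : (∏ j ∈ Finset.range i, N j) ∣ ∏ j ∈ Finset.range k, N j :=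
      Finset.prod_dvd_prod_of_subset _ _ _ (Finset.range_mono hik)
    have hM := h.prod_pos i
    have hx := h.labelPos_lt x k
    have hy := h.labelPos_lt y k
    rw [labelPos, labelPos, hQ, mul_assoc, mul_assoc, Nat.add_mul_div_left _ _ hM,
      Nat.add_mul_div_left _ _ hM]
    rw [hQ] at hx hy
    have hx' := Nat.div_lt_of_lt_mul hx
    have hy' := Nat.div_lt_of_lt_mul hy
    constructor
    · intro hi
      have hk : E k x y := hE hik hi
      rw [(ih hk).1 hi, h.congr k x y hk]
    · intro heq
      have ho : o k x = o k y := by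
        have h1 := congrArg (· / Q) heq
        have hQ0 : 0 < Q := (Nat.zero_le _).trans_lt hx'
        simpa [Nat.add_mul_div_left _ _ hQ0, Nat.div_eq_of_lt hx', Nat.div_eq_of_lt hy'] using h1
      refine (ih (h.rel k x y hxy ho)).2 ?_
      rw [ho] at heq
      exact Nat.add_right_cancel heq

/-- The classes of x₀ carry the digit 0, so positions stabilize and give one global code. -/
theorem IsLabelling.labelPos_eq (h : IsLabelling E x₀ N o) (hE : Monotone E) {k l : ℕ} (hkl : k ≤ l)
    {x : X} (hx : E k x x₀) : labelPos N o x l = labelPos N o x k := by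
  induction l, hkl using Nat.le_induction with
  | base => rfl
  | succ l hl ih =>
    rw [labelPos, h.zero l x (hE hl hx), mul_zero, add_zero, ih]

/-- A tower with a labelling embeds into the natural numbers. -/
theorem IsLabelling.exists_code (h : IsLabelling E x₀ N o) (hE : Monotone E)
    (hex : ∀ x y, ∃ i, E i x y) : ∃ g : X → ℕ, ∀ i x y, E i x y ↔
      g x / (∏ j ∈ Finset.range i, N j) = g y / (∏ j ∈ Finset.range i, N j) := by
  choose K hK using fun x => hex x x₀
  refine ⟨fun x => labelPos N o x (K x), fun i x y => ?_⟩
  obtain ⟨k, hkx, hky, hik⟩ : ∃ k, K x ≤ k ∧ K y ≤ k ∧ i ≤ k :=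
    ⟨max (max (K x) (K y)) i, (le_max_left _ _).trans (le_max_left _ _),
      (le_max_right _ _).trans (le_max_left _ _), le_max_right _ _⟩
  beta_reduce
  rw [← h.labelPos_eq hE hkx (hK x), ← h.labelPos_eq hE hky (hK y)]
  exact h.rel_iff_div hE hik ((E k).trans (hE hkx (hK x)) ((E k).symm (hE hky (hK y))))

theorem exists_injOn_lt {α : Type u} {Q : Set α} {n : ℕ} (hn : 0 < n) (hQ : #Q ≤ n) (a : α) :
    ∃ e : α → ℕ, (∀ d, e d < n) ∧ Set.InjOn e Q ∧ (a ∈ Q → e a = 0) := by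
  classical
  have hQ' : lift.{0} #Q ≤ lift.{u} #(Fin n) := by simpa using hQ
  obtain ⟨f⟩ := lift_mk_le'.1 hQ'
  let σ : Equiv.Perm (Fin n) := if h : a ∈ Q then Equiv.swap (f ⟨a, h⟩) ⟨0, hn⟩ else 1
  refine ⟨fun d => if h : d ∈ Q then σ (f ⟨d, h⟩) else 0, fun d => ?_, fun d hd d' hd' h => ?_,
    fun h => ?_⟩
  · by_cases h : d ∈ Q
    · simp only [dif_pos h, Fin.is_lt]
    · simpa only [dif_neg h] using hn
  · simp only [dif_pos hd, dif_pos hd'] at h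
    exact congrArg Subtype.val (f.injective (σ.injective (Fin.ext h)))
  · simp only [dif_pos h, σ, Equiv.swap_apply_left]

theorem exists_isLabelling (hE : Monotone E) (x₀ : X) (N : ℕ → ℕ)
    (hN : ∀ k p, #(classesIn (E k) (E (k + 1)) p) ≤ N k) : ∃ o, IsLabelling E x₀ N o := by
  have hN0 : ∀ k, 0 < N k := by
    intro k
    have h := (pos_iff_ne_zero.2 (mk_classesIn_ne_zero (L := E k) (D := E (k + 1)) x₀)).trans_le
      (hN k x₀)
    exact_mod_cast h
  choose e h1 h2 h3 using fun k (c : Quotient (E (k + 1))) =>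
    exists_injOn_lt (hN0 k) (hN k c.out) (Quotient.mk (E k) x₀)
  have hmem : ∀ k x, Quotient.mk (E k) x ∈
      classesIn (E k) (E (k + 1)) (Quotient.mk (E (k + 1)) x).out := fun k x =>
    ⟨x, (E (k + 1)).symm (Quotient.exact (Quotient.out_eq _)), rfl⟩
  have hle : ∀ k, E k ≤ E (k + 1) := fun k => hE (Nat.le_succ k)
  refine ⟨fun k x => e k (Quotient.mk _ x) (Quotient.mk _ x), ⟨fun k x y hxy => ?_,
    fun k x y hxy ho => ?_, fun k x => h1 _ _ _, fun k x hx => ?_⟩⟩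
  · rw [show Quotient.mk (E k) x = Quotient.mk (E k) y from Quotient.sound hxy,
      show Quotient.mk (E (k + 1)) x = Quotient.mk (E (k + 1)) y from Quotient.sound (hle k hxy)]
  · have hc : Quotient.mk (E (k + 1)) x = Quotient.mk (E (k + 1)) y := Quotient.sound hxy
    have hy := hmem k y
    rw [← hc] at hy
    simp only [← hc] at ho
    exact Quotient.exact (h2 k _ (hmem k x) hy ho)
  · have hc : Quotient.mk (E k) x = Quotient.mk (E k) x₀ := Quotient.sound hx
    have hm := hmem k x
    rw [hc] at hm ⊢
    exact h3 k _ hm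

open Classical in
theorem count_add_card_filter_Ico (Z : Set ℕ) {a b : ℕ} (h : a ≤ b) :
    Nat.count (· ∈ Z) b = Nat.count (· ∈ Z) a + ((Finset.Ico a b).filter (· ∈ Z)).card := by
  rw [Nat.count_eq_card_filter_range, Nat.count_eq_card_filter_range,
    ← Finset.card_union_of_disjoint, ← Finset.filter_union, Finset.range_eq_Ico, Finset.range_eq_Ico,
    Finset.Ico_union_Ico_eq_Ico (Nat.zero_le a) h]
  refine Finset.disjoint_filter_filter ?_
  rw [Finset.range_eq_Ico]
  exact Finset.Ico_disjoint_Ico_consecutive 0 a b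

open Classical in
theorem mk_classesIn_eq_card {L D : Setoid X} {g : X → ℕ} {M : ℕ} (hM : 0 < M)
    (hL : ∀ x y, L x y ↔ g x = g y) (hD : ∀ x y, D x y ↔ g x / M = g y / M) (x : X) :
    #(classesIn L D x) = ((Finset.Ico (g x / M * M) ((g x / M + 1) * M)).filter
      (· ∈ Set.range g)).card := by
  let g' : Quotient L → ℕ := Quotient.lift g fun a b h => (hL a b).1 h
  have hinj : Function.Injective g' := by
    intro a b
    induction a using Quotient.inductionOn with
    | h a =>
    induction b using Quotient.inductionOn with
    | h b => exact fun h => Quotient.sound ((hL a b).2 h)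
  have himg : g' '' classesIn L D x = ((Finset.Ico (g x / M * M) ((g x / M + 1) * M)).filter
      (· ∈ Set.range g) : Finset ℕ) := by
    have hiff : ∀ n, n / M = g x / M ↔ g x / M * M ≤ n ∧ n < (g x / M + 1) * M := by
      intro n
      rw [← Nat.le_div_iff_mul_le hM, ← Nat.div_lt_iff_lt_mul hM]
      omega
    ext n
    simp only [classesIn, Set.image_image, Set.mem_image, Set.mem_setOf_eq, Finset.coe_filter,
      Finset.mem_Ico, ← hiff, hD]
    constructor
    · rintro ⟨y, hy, rfl⟩
      exact ⟨hy, y, rfl⟩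
    · rintro ⟨hn, y, rfl⟩
      exact ⟨y, hn, rfl⟩
  have := mk_image_eq_of_injOn_lift g' (classesIn L D x) hinj.injOn
  rw [himg, Finset.coe_sort_coe, mk_coe_finset, lift_natCast, lift_uzero] at this
  exact this.symm

/-- A tower of equivalence relations of finite type is represented by a line. -/
theorem exists_isLine [Nonempty X] (hE : Monotone E) (hex : ∀ x y, ∃ i, E i x y)
    (hb : ∀ i, ∃ b : ℕ, ∀ p, #(classesIn (E 0) (E i) p) ≤ b)
    (hl : ∀ n : ℕ, ∃ i, ∀ p, n ≤ #(classesIn (E 0) (E i) p)) :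
    ∃ π P, IsLine E π P := by
  classical
  obtain ⟨x₀⟩ := ‹Nonempty X›
  choose b hb using hb
  obtain ⟨o, ho⟩ := exists_isLabelling hE x₀ (fun k => b (k + 1)) fun k p =>
    (mk_classesIn_le_of_le (hE (Nat.zero_le k)) p).trans (hb (k + 1) p)
  obtain ⟨g, hg⟩ := ho.exists_code hE hex
  let M : ℕ → ℕ := fun i => ∏ j ∈ Finset.range i, b (j + 1)
  have hM : ∀ i, 0 < M i := ho.prod_pos
  have hg : ∀ i x y, E i x y ↔ g x / M i = g y / M i := hg
  have hg0 : ∀ x y, E 0 x y ↔ g x = g y := by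
    intro x y
    rw [hg 0]
    simp [M]
  let Z := Set.range g
  -- The codes may leave gaps, since N k is only an upper bound. Counting the codes below a number
  -- closes them, and a block then has as many points as its class has `E 0`-classes.
  let ct : ℕ → ℕ := Nat.count (· ∈ Z)
  have hmono : Monotone ct := Nat.count_monotone _
  have hblock : ∀ i x, ∃ m : ℕ, #(classesIn (E 0) (E i) x) = m ∧
      ct ((g x / M i + 1) * M i) = ct (g x / M i * M i) + m := fun i x =>
    ⟨_, mk_classesIn_eq_card (hM i) hg0 (hg i) x,
      count_add_card_filter_Ico Z (Nat.mul_le_mul_right _ (Nat.le_succ _))⟩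
  have hZ : {n | n ∈ Z}.Infinite := by
    intro hfin
    obtain ⟨i, hi⟩ := hl (hfin.toFinset.card + 1)
    obtain ⟨m, hm, hct⟩ := hblock i x₀
    have h1 := hi x₀
    rw [hm] at h1
    have h2 : hfin.toFinset.card + 1 ≤ m := by exact_mod_cast h1
    have h3 : ct ((g x₀ / M i + 1) * M i) ≤ hfin.toFinset.card := by
      simp only [ct, Nat.count_eq_card_filter_range]
      refine Finset.card_le_card fun z hz => ?_
      exact hfin.mem_toFinset.2 (Finset.mem_filter.1 hz).2
    omega
  have hctle : ∀ n x, ct n ≤ ct (g x) ↔ n ≤ g x := by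
    intro n x
    refine ⟨fun h => ?_, fun h => hmono h⟩
    by_contra! hlt
    exact absurd h (not_le.2 (Nat.count_strict_mono (p := (· ∈ Z)) ⟨x, rfl⟩ hlt))
  refine ⟨fun x => ct (g x), fun i => Set.range fun t => ct (t * M i), ⟨fun n => ?_, fun i => ?_,
    fun i j hij => ?_, fun i x y => ?_, fun i => ⟨b i, fun n => ?_⟩, fun n => ?_⟩⟩
  · obtain ⟨x, hx⟩ := Nat.nth_mem_of_infinite hZ n
    refine ⟨x, ?_⟩
    simp only [hx]
    exact Nat.count_nth_of_infinite hZ n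
  · exact ⟨0, by simp [ct]⟩
  · rintro _ ⟨t, rfl⟩
    obtain ⟨Q, hQ⟩ : M i ∣ M j := Finset.prod_dvd_prod_of_subset _ _ _ (Finset.range_mono hij)
    refine ⟨t * Q, ?_⟩
    simp only [hQ]
    congr 1
    ring
  · rw [hg, Set.forall_mem_range]
    simp only [hctle, ← Nat.le_div_iff_mul_le (hM i)]
    exact ⟨fun h t => by rw [h], fun h => le_antisymm ((h _).1 le_rfl) ((h _).2 le_rfl)⟩
  · obtain ⟨x, hx⟩ := Nat.nth_mem_of_infinite hZ n
    have hn : ct (g x) = n := by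
      rw [hx]
      exact Nat.count_nth_of_infinite hZ n
    obtain ⟨m, hm, hct⟩ := hblock i x
    have hmb : m ≤ b i := by
      have := hb i x
      rw [hm] at this
      exact_mod_cast this
    refine ⟨_, ⟨g x / M i, rfl⟩, ?_, ?_⟩
    · rw [← hn]
      exact hmono (Nat.div_mul_le_self _ _)
    · have h1 : g x < (g x / M i + 1) * M i := by
        rw [← Nat.div_lt_iff_lt_mul (hM i)]
        exact Nat.lt_succ_self _
      have h2 : ct (g x) < ct ((g x / M i + 1) * M i) :=
        Nat.count_strict_mono (p := (· ∈ Z)) ⟨x, rfl⟩ h1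
      beta_reduce
      omega
  -- Between two distinct cuts lies a nonempty block, which has at least n points; empty blocks
  -- merely make cuts coincide.
  · obtain ⟨i, hi⟩ := hl n
    refine ⟨i, ?_⟩
    rintro _ ⟨t, rfl⟩ _ ⟨t', rfl⟩ hlt
    beta_reduce at hlt ⊢
    obtain ⟨x, hx⟩ := Nat.nth_mem_of_infinite hZ (ct (t * M i))
    have h1 : t * M i ≤ g x := by
      rw [hx]
      exact Nat.le_nth_count hZ _
    have h2 : g x < t' * M i := by
      rw [hx]
      exact Nat.nth_lt_of_lt_count hlt
    obtain ⟨m, hm, hct⟩ := hblock i x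
    have hnm : n ≤ m := by
      have := hi x
      rw [hm] at this
      exact_mod_cast this
    have h3 : ct (t * M i) ≤ ct (g x / M i * M i) :=
      hmono (Nat.mul_le_mul_right _ ((Nat.le_div_iff_mul_le (hM i)).2 h1))
    have h4 : ct ((g x / M i + 1) * M i) ≤ ct (t' * M i) :=
      hmono (Nat.mul_le_mul_right _ ((Nat.div_lt_iff_lt_mul (hM i)).2 h2))
    omega

end Construction

/-! ### The countable case and the theorem -/

namespace Ballean

/-- A filtered ballean with countable cofinality and with both covering numbers countable is
represented by a line. -/
theorem IsFiltered.exists_isLine {X : Type u} [Nonempty X] {E : Ballean X} {I : Type v}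
    [LinearOrder I] (hE : E.IsFiltered I) (e : I ≃ ℕ) (h₁ : E.covSharp ≤ ℵ₀)
    (h₂ : ℵ₀ ≤ E.covFlat) : ∃ (R : ℕ → Setoid X) (π : X → ℕ) (P : ℕ → Set ℕ),
      (∀ i, E.Bdd (R i)) ∧ Monotone R ∧
      (∀ ε ∈ E.radii, ∃ i, ∀ x y, (x, y) ∈ ε → R i x y) ∧ IsLine R π P := by
  obtain ⟨b, hb, hbn⟩ := hE.exists_forall_le
  obtain ⟨S, hS, hSc⟩ := hE.cofinal
  have hstep : ∀ (n : ℕ) (T : {T // E.Bdd T}), ∃ U : {U // E.Bdd U}, T.1 ≤ U.1 ∧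
      S (e.symm n) ≤ U.1 := fun n T =>
    let ⟨U, hU, h1, h2⟩ := hE.exists_sup T.2 (hS (e.symm n))
    ⟨⟨U, hU⟩, h1, h2⟩
  choose next hn₁ hn₂ using hstep
  -- The tower starts at b because finiteness of the counts is known relative to b.
  let R : ℕ → {T // E.Bdd T} := fun n => Nat.rec ⟨b, hb⟩ (fun k T => next k T) n
  have hRm : Monotone fun n => (R n).1 := monotone_nat_of_le_succ fun n => hn₁ n (R n)
  have hRS : ∀ ε ∈ E.radii, ∃ i, ∀ x y, (x, y) ∈ ε → (R i).1 x y := by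
    intro ε hε
    obtain ⟨i, hi⟩ := hSc ε hε
    refine ⟨e i + 1, fun x y hxy => hn₂ (e i) (R (e i)) ?_⟩
    rw [e.symm_apply_apply]
    exact hi x y hxy
  obtain ⟨π, P, hP⟩ := _root_.exists_isLine (E := fun n => (R n).1) hRm (fun x y => by
      obtain ⟨ε, hε, h⟩ := E.exists_mem_radii x y
      exact (hRS ε hε).imp fun i hi => hi x y h) (fun i => by
      obtain ⟨n, hn, h⟩ := hbn _ (R i).2
      obtain ⟨m, rfl⟩ := lt_aleph0.1 (hn.trans_le h₁)
      exact ⟨m, h⟩) (fun n => by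
      obtain ⟨D, ⟨δ, hδ, hD⟩, h⟩ := hE.exists_forall_ge hb
        (natCast_lt_aleph0.trans_le h₂ : (n : Cardinal) < _)
      obtain ⟨i, hi⟩ := hRS δ hδ
      refine ⟨i, fun p => (h p).trans (mk_le_mk_of_subset (classesIn_mono ?_ p))⟩
      exact fun x y hxy => hi x y (hD x y hxy))
  exact ⟨_, π, P, fun i => (R i).2, hRm, hRS, hP⟩

theorem exists_isCoarseEmbedding_isLarge_of_aleph0 {X : Type u} {Y : Type v} [Nonempty X]
    [Nonempty Y] {E : Ballean X} {F : Ballean Y} {I : Type*} [LinearOrder I]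
    (hE : E.IsFiltered I) (hF : F.IsFiltered I) (e : I ≃ ℕ) (h₁ : E.covSharp ≤ ℵ₀)
    (h₂ : ℵ₀ ≤ E.covFlat) (h₃ : F.covSharp ≤ ℵ₀) (h₄ : ℵ₀ ≤ F.covFlat) :
    ∃ f : X → Y, IsCoarseEmbedding E F f ∧ F.IsLarge (Set.range f) := by
  obtain ⟨R, π, A, hR, hRm, hRc, hA⟩ := hE.exists_isLine e h₁ h₂
  obtain ⟨S, ρ, B, hS, hSm, hSc, hB⟩ := hF.exists_isLine e h₃ h₄
  exact exists_isCoarseEmbedding_of_isLine hR hS hRm hSm hRc hSc hA hB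

end Ballean

theorem mainTheorem5 {X : Type u} [Nonempty X] (E : Ballean X)
    (hcell : E.IsCellular) (hord : E.IsOrdinal)
    (γ : Ordinal.{u}) (hγ : γ ≠ 0) (hcof : E.cof = γ.cof) :
    (cardinalTail γ ≤ E.covFlat →
      ∃ A : Set X, Ballean.CoarselyEquivalent (Ballean.cantorMacroCube γ hγ) (E.sub A)) ∧
    (E.covSharp ≤ cardinalTail γ →
      ∃ A : Set (γ.ToType →₀ Fin 2),
        Ballean.CoarselyEquivalent E ((Ballean.cantorMacroCube γ hγ).sub A)) ∧
    (E.covFlat = cardinalTail γ → E.covSharp = cardinalTail γ →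
      Ballean.CoarselyEquivalent E (Ballean.cantorMacroCube γ hγ)) := by
  rcases Ordinal.zero_or_succ_or_isSuccLimit γ with h0 | hs | hlim
  · exact absurd h0 hγ
  · have h1 : γ.cof = 1 := Ordinal.cof_eq_one_iff.2 hs
    have hX := Ballean.exists_radius_univ_of_cof_eq_one (hcof.trans h1)
    have hC := Ballean.exists_radius_univ_cantorMacroCube hγ h1
    refine ⟨fun _ => ?_, fun _ => ?_, fun _ _ => ?_⟩
    · obtain ⟨f, hf, -⟩ := Ballean.exists_isCoarseEmbedding_of_univ hC hX
      exact ⟨_, hf.coarselyEquivalent_range⟩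
    · obtain ⟨f, hf, -⟩ := Ballean.exists_isCoarseEmbedding_of_univ hX hC
      exact ⟨_, hf.coarselyEquivalent_range⟩
    · obtain ⟨f, hf, hl⟩ := Ballean.exists_isCoarseEmbedding_of_univ hX hC
      exact hf.coarselyEquivalent hl
  · have hX : E.IsFiltered γ.cof.ord.ToType := hcof ▸ hord.isFiltered hcell
    have hC := Ballean.cantorMacroCube_isFiltered hγ
    have hCs := Ballean.covSharp_cantorMacroCube_le hγ hlim
    have hCf := Ballean.le_covFlat_cantorMacroCube hγ
    refine ⟨fun h => ?_, fun h => ?_, fun h₁ h₂ => ?_⟩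
    · obtain ⟨f, hf⟩ := Ballean.exists_isCoarseEmbedding hC hX (hCs.trans h)
      exact ⟨_, hf.coarselyEquivalent_range⟩
    · obtain ⟨f, hf⟩ := Ballean.exists_isCoarseEmbedding hX hC (h.trans hCf)
      exact ⟨_, hf.coarselyEquivalent_range⟩
    · rcases (Ballean.aleph0_le_cardinalTail hlim).eq_or_lt with ht | ht
      -- A tail equal to ℵ₀ forces cofinality ω, so the index set is countable and lines are
      -- available.
      · obtain ⟨e⟩ : Nonempty (γ.cof.ord.ToType ≃ ℕ) := by
          rw [← lift_mk_eq', mk_ord_toType,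
            Ballean.cof_eq_aleph0_of_cardinalTail hlim ht.symm]
          simp
        obtain ⟨f, hf, hl⟩ := Ballean.exists_isCoarseEmbedding_isLarge_of_aleph0 hX hC e
          (h₂.trans ht.symm).le (ht.trans h₁.symm).le (hCs.trans ht.symm.le) (ht.le.trans hCf)
        exact hf.coarselyEquivalent hl
      · obtain ⟨f, hf, hl⟩ := Ballean.exists_isCoarseEmbedding_isLarge hX hC ht h₂.le h₁.ge hCs hCf
        exact hf.coarselyEquivalent hl
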